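/- **Proposition (Necessary conditions, antisymmetric case, normalized error).** Let $S_1\colon H_1\to G_1$ be a compact linear operator between (real or complex) Hilbert spaces, and let $\lambda=(\lambda_m)_{m\ge 1}$ be the non-increasing sequence of the eigenvalues of $W_1=S_1^\dagger S_1$, repeated according to multiplicity (all non-zero eigenvalues are listed, and the sequence ends with zeros if there are only finitely many of them). Assume $\lambda_2>0$. For every $d\ge 1$ let $S_d=S_1\otimes\dots\otimes S_1\colon H_d\to G_d$ be the $d$-fold tensor product operator between the Hilbert space tensor powers $H_d=H_1\otimes\dots\otimes H_1$ and $G_d=G_1\otimes\dots\otimes G_1$, let $\emptyset\ne I_d\subset\{1,\dots,d\}$, put $a_d=\#I_d$ and $b_d=d-a_d$, and let $\mathfrak A_{I_d}(H_d)$ be the subspace of $I_d$-antisymmetric elements of $H_d$, that is, the range of the antisymmetrizer $\frac{1}{\#\mathcal S_{I_d}}\sum_{\pi\in\mathcal S_{I_d}}\operatorname{sign}(\pi)\,\pi$, where $\mathcal S_{I_d}$ is the set of permutations of $\{1,\dots,d\}$ that fix every element outside $I_d$, and $\pi(f_1\otimes\dots\otimes f_d)=f_{\pi(1)}\otimes\dots\otimes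 f_{\pi(d)}$. Consider the approximation of the restrictions $S_d\colon \mathfrak A_{I_d}(H_d)\to G_d$ in the worst case setting. For $n\ge 0$ let $e(n,d)=\inf_A\sup_{\|f\|\le 1}\|A(f)-S_d f\|$, where the infimum is over all algorithms $A$ that use $n$ (adaptively chosen) continuous linear functionals; let $\epsilon_d^{\rm init}=e(0,d)$ be the initial error, and for $\epsilon>0$ let $n(\epsilon,d)=\min\{n\ge 0 : e(n,d)\le\epsilon\}$. Assume $\epsilon_d^{\rm init}>0$ for all $d\ge 1$. The problem $\{S_d\}$ is called polynomially tractable for the normalized error criterion with the constants $C,p>0$ and $q\ge 0$ if $$n(\epsilon'\epsilon_d^{\rm init},d)\le C\,(\epsilon')^{-p}\,d^{\,q}\qquad\text{for all } d\ge 1 \text{ and } \epsilon'\in(0,1],$$ and strongly polynomially tractable if this holds with $q=0$ for some $C,p>0$. If $\{S_d\}$ is polynomially tractable for the normalized error criterion with the constants $C,p>0$ and $q\ge0$, then 1. $\lambda\in\ell_\tau$ for all $\tau>p/2$; 2. $\epsilon_d^{\rm init}$ tends to zero faster than the inverse of any polynomial, i.e. $d^k\epsilon_d^{\rm init}\to 0$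 as $d\to\infty$ for every $k\in\mathbb N$; 3. $b_d=O(\ln d)$ as $d\to\infty$, and therefore $\lim_{d\to\infty}a_d/d=1$. If $\{S_d\}$ is strongly polynomially tractable for the normalized error criterion, then moreover $b_d=O(1)$. -/

import Mathlib

open scoped ENNReal ComplexConjugate InnerProductSpace

set_option linter.unusedSectionVars false

noncomputable section

/-! ### The `d`-fold Hilbert space tensor power -/

section TensorPower

open Matrix ComplexOrder in
/-- Entrywise products of Gram matrices are positive semidefinite. -/
theorem posSemidef_prod_gram (𝕜 : Type*) {H ι κ : Type*} [RCLike 𝕜] [NormedAddCommGroup H]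
    [InnerProductSpace 𝕜 H] (s : Finset ι) (v : ι → κ → H) :
    (Matrix.of fun x y : κ => ∏ l ∈ s, (inner 𝕜 (v l x) (v l y) : 𝕜)).PosSemidef := by
  classical
  have hgram : ∀ w : κ → H, (gram 𝕜 w).PosSemidef := by
    intro w
    refine ⟨isHermitian_gram 𝕜 w, fun c => ?_⟩
    have h : (c.sum fun x a => c.sum fun y b => star a * gram 𝕜 w x y * b)
        = inner 𝕜 (c.sum fun x a => a • w x) (c.sum fun x a => a • w x) := by
      simp only [Finsupp.sum, sum_inner, inner_sum, inner_smul_left, inner_smul_right, gram_apply,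
        RCLike.star_def, Finset.mul_sum]
      rw [Finset.sum_comm]
      refine Finset.sum_congr rfl fun x _ => Finset.sum_congr rfl fun y _ => ?_
      ring
    rw [h, RCLike.le_iff_re_im]
    simp
  induction s using Finset.induction_on with
  | empty =>
    have h1 := hgram (fun _ => (0 : H))
    refine ⟨?_, fun c => ?_⟩
    · ext x y; simp
    · have h : (c.sum fun x a => c.sum fun y b =>
          star a * (Matrix.of fun x y : κ => ∏ l ∈ (∅ : Finset ι), inner 𝕜 (v l x) (v l y)) x y * b)
          = star (c.sum fun _ a => a) * (c.sum fun _ a => a) := by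
        simp [Finsupp.sum, Finset.sum_mul_sum]
      rw [h]
      exact star_mul_self_nonneg _
  | insert i s hi ih =>
    have := (hgram (v i)).hadamard ih
    convert this using 1
    ext x y
    simp [Finset.prod_insert hi]

open Matrix ComplexOrder in
/-- Comparison of the entrywise products of Gram matrices before and after applying a bounded
linear map. -/
theorem posSemidef_prod_gram_sub {𝕜 H G ι κ : Type*} [RCLike 𝕜] [NormedAddCommGroup H]
    [InnerProductSpace 𝕜 H] [NormedAddCommGroup G] [InnerProductSpace 𝕜 G]
    (S : H →L[𝕜] G) (s : Finset ι) (v : ι → κ → H) :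
    ((Matrix.of fun x y : κ => (((‖S‖ ^ 2) ^ s.card : ℝ) : 𝕜) * ∏ l ∈ s, inner 𝕜 (v l x) (v l y)) -
      Matrix.of fun x y : κ => ∏ l ∈ s, inner 𝕜 (S (v l x)) (S (v l y))).PosSemidef := by
  classical
  induction s using Finset.induction_on with
  | empty =>
    convert (Matrix.PosSemidef.zero : (0 : Matrix κ κ 𝕜).PosSemidef) using 1
    ext x y
    simp
  | insert i s hi ih =>
    have h1 := (posSemidef_opNorm_smul_gram_sub_gram (v i) S).hadamard
      (posSemidef_prod_gram 𝕜 s (fun l x => S (v l x)))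
    have h0 := posSemidef_prod_gram 𝕜 {i} v
    have h2 := (h0.hadamard ih).smul (a := ‖S‖ ^ 2) (by positivity)
    convert h2.add h1 using 1
    ext x y
    simp only [Finset.prod_insert hi, Finset.card_insert_of_notMem hi, Matrix.sub_apply,
      Matrix.add_apply, Matrix.smul_apply, Matrix.hadamard_apply, Matrix.of_apply, gram_apply,
      Function.comp_apply, Finset.prod_singleton, RCLike.real_smul_eq_coe_mul]
    push_cast
    ring

/-- The sesquilinear form with `⟪f₁ ⊗ ⋯ ⊗ f_d, g₁ ⊗ ⋯ ⊗ g_d⟫ = ∏ l, ⟪f_l, g_l⟫` on finite formal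
linear combinations of the formal objects `f₁ ⊗ ⋯ ⊗ f_d` with `f_l ∈ H`. -/
def tensorForm {𝕜 H : Type*} [RCLike 𝕜] [NormedAddCommGroup H] [InnerProductSpace 𝕜 H] {d : ℕ}
    (x y : (Fin d → H) →₀ 𝕜) : 𝕜 :=
  x.sum fun f a => y.sum fun g b => star a * (∏ l, inner 𝕜 (f l) (g l)) * b

section TensorForm

variable {𝕜 H G : Type*} [RCLike 𝕜] [NormedAddCommGroup H] [InnerProductSpace 𝕜 H]
  [NormedAddCommGroup G] [InnerProductSpace 𝕜 G] {d : ℕ}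

theorem tensorForm_conj_symm (x y : (Fin d → H) →₀ 𝕜) :
    conj (tensorForm y x) = tensorForm x y := by
  rw [tensorForm, tensorForm, Finsupp.sum_comm]
  simp only [map_finsuppSum]
  refine Finsupp.sum_congr fun f _ => Finsupp.sum_congr fun g _ => ?_
  simp only [map_mul, map_prod, inner_conj_symm, RCLike.star_def, RCLike.conj_conj]
  ring

open ComplexOrder in
theorem tensorForm_re_nonneg (x : (Fin d → H) →₀ 𝕜) : 0 ≤ RCLike.re (tensorForm x x) := by
  have h := (posSemidef_prod_gram 𝕜 (κ := Fin d → H) Finset.univ (fun l f => f l)).2 x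
  have h' := (RCLike.le_iff_re_im.mp h).1
  rw [map_zero] at h'
  exact h'

theorem tensorForm_add_left (x y z : (Fin d → H) →₀ 𝕜) :
    tensorForm (x + y) z = tensorForm x z + tensorForm y z := by
  simp only [tensorForm]
  rw [Finsupp.sum_add_index'] <;> simp [← Finsupp.sum_add, add_mul]

theorem tensorForm_smul_left (x y : (Fin d → H) →₀ 𝕜) (r : 𝕜) :
    tensorForm (r • x) y = conj r * tensorForm x y := by
  simp only [tensorForm]
  rw [Finsupp.sum_smul_index] <;> simp [Finsupp.mul_sum, ← mul_assoc]

theorem tensorForm_mapDomain (φ : (Fin d → H) → (Fin d → G)) (x y : (Fin d → H) →₀ 𝕜) :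
    tensorForm (x.mapDomain φ) (y.mapDomain φ) =
      x.sum fun f a => y.sum fun g b => star a * (∏ l, inner 𝕜 (φ f l) (φ g l)) * b := by
  simp only [tensorForm]
  rw [Finsupp.sum_mapDomain_index (by simp) (by simp [← Finsupp.sum_add, add_mul])]
  refine Finsupp.sum_congr fun f _ => ?_
  rw [Finsupp.sum_mapDomain_index (by simp) (by simp [mul_add])]

theorem tensorForm_permute (π : Equiv.Perm (Fin d)) (x : (Fin d → H) →₀ 𝕜) :
    tensorForm (x.mapDomain fun f l => f (π l)) (x.mapDomain fun f l => f (π l)) =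
      tensorForm x x := by
  rw [tensorForm_mapDomain, tensorForm]
  refine Finsupp.sum_congr fun f _ => Finsupp.sum_congr fun g _ => ?_
  rw [Equiv.prod_comp π (fun l => (inner 𝕜 (f l) (g l) : 𝕜))]

open ComplexOrder in
theorem tensorForm_map_le (S : H →L[𝕜] G) (x : (Fin d → H) →₀ 𝕜) :
    RCLike.re (tensorForm (x.mapDomain fun f l => S (f l)) (x.mapDomain fun f l => S (f l))) ≤
      (‖S‖ ^ 2) ^ d * RCLike.re (tensorForm x x) := by
  have h := (posSemidef_prod_gram_sub S (κ := Fin d → H) Finset.univ (fun l f => f l)).2 x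
  have e2 : (x.sum fun f a => x.sum fun g b => star a *
      ((Matrix.of fun f g : Fin d → H => (((‖S‖ ^ 2) ^ (Finset.univ : Finset (Fin d)).card : ℝ) : 𝕜) *
        ∏ l, (inner 𝕜 (f l) (g l) : 𝕜)) -
      Matrix.of fun f g : Fin d → H => ∏ l, (inner 𝕜 (S (f l)) (S (g l)) : 𝕜)) f g * b)
      = (((‖S‖ ^ 2) ^ d : ℝ) : 𝕜) * tensorForm x x -
        tensorForm (x.mapDomain fun f l => S (f l)) (x.mapDomain fun f l => S (f l)) := by
    rw [tensorForm_mapDomain, tensorForm, Finsupp.mul_sum, ← Finsupp.sum_sub]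
    refine Finsupp.sum_congr fun f _ => ?_
    rw [Finsupp.mul_sum, ← Finsupp.sum_sub]
    refine Finsupp.sum_congr fun g _ => ?_
    simp only [Matrix.sub_apply, Matrix.of_apply, Finset.card_univ, Fintype.card_fin]
    ring
  rw [e2] at h
  have h' := (RCLike.le_iff_re_im.mp h).1
  rw [map_sub, RCLike.re_ofReal_mul, map_zero] at h'
  linarith

end TensorForm

/-- Finite formal linear combinations of the formal objects `f₁ ⊗ ⋯ ⊗ f_d` with `f_l ∈ H`,
with the semi-inner product `tensorForm`. -/
def FormalTensor (𝕜 H : Type*) [RCLike 𝕜] (d : ℕ) : Type _ := (Fin d → H) →₀ 𝕜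

namespace FormalTensor

variable {𝕜 H G : Type*} [RCLike 𝕜] [NormedAddCommGroup H] [InnerProductSpace 𝕜 H]
  [NormedAddCommGroup G] [InnerProductSpace 𝕜 G] {d : ℕ}

instance : AddCommGroup (FormalTensor 𝕜 H d) := inferInstanceAs (AddCommGroup ((Fin d → H) →₀ 𝕜))

instance : Module 𝕜 (FormalTensor 𝕜 H d) := inferInstanceAs (Module 𝕜 ((Fin d → H) →₀ 𝕜))

instance instCore : PreInnerProductSpace.Core 𝕜 (FormalTensor 𝕜 H d) where
  inner x y := tensorForm x y
  conj_inner_symm := tensorForm_conj_symm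
  re_inner_nonneg := tensorForm_re_nonneg
  add_left := tensorForm_add_left
  smul_left := tensorForm_smul_left

instance : SeminormedAddCommGroup (FormalTensor 𝕜 H d) :=
  InnerProductSpace.Core.toSeminormedAddCommGroup (𝕜 := 𝕜)

instance : InnerProductSpace 𝕜 (FormalTensor 𝕜 H d) := .ofCore _

theorem inner_def (x y : FormalTensor 𝕜 H d) : inner 𝕜 x y = tensorForm (𝕜 := 𝕜) (H := H) x y := rfl

/-- The formal object `f₁ ⊗ ⋯ ⊗ f_d`. -/
def single (f : Fin d → H) : FormalTensor 𝕜 H d := Finsupp.single f 1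

theorem inner_single (f g : Fin d → H) :
    inner 𝕜 (single f : FormalTensor 𝕜 H d) (single g) = ∏ l, inner 𝕜 (f l) (g l) := by
  rw [inner_def]
  simp [single, tensorForm]

/-- The linear map `f₁ ⊗ ⋯ ⊗ f_d ↦ S f₁ ⊗ ⋯ ⊗ S f_d` on formal linear combinations. -/
def mapₗ (S : H →L[𝕜] G) (d : ℕ) : FormalTensor 𝕜 H d →ₗ[𝕜] FormalTensor 𝕜 G d :=
  Finsupp.lmapDomain 𝕜 𝕜 (fun (f : Fin d → H) l => S (f l))

theorem mapₗ_single (S : H →L[𝕜] G) (f : Fin d → H) :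
    mapₗ S d (single f : FormalTensor 𝕜 H d) = single fun l => S (f l) :=
  Finsupp.mapDomain_single

/-- The linear map `f₁ ⊗ ⋯ ⊗ f_d ↦ f_{π(1)} ⊗ ⋯ ⊗ f_{π(d)}` on formal linear combinations. -/
def permuteₗ (π : Equiv.Perm (Fin d)) : FormalTensor 𝕜 H d →ₗ[𝕜] FormalTensor 𝕜 H d :=
  Finsupp.lmapDomain 𝕜 𝕜 (fun (f : Fin d → H) l => f (π l))

theorem permuteₗ_single (π : Equiv.Perm (Fin d)) (f : Fin d → H) :
    permuteₗ π (single f : FormalTensor 𝕜 H d) = single fun l => f (π l) :=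
  Finsupp.mapDomain_single

theorem norm_mapₗ_le (S : H →L[𝕜] G) (x : FormalTensor 𝕜 H d) :
    ‖mapₗ S d x‖ ≤ ‖S‖ ^ d * ‖x‖ := by
  have h : RCLike.re (inner 𝕜 (mapₗ S d x) (mapₗ S d x)) ≤
      (‖S‖ ^ 2) ^ d * RCLike.re (inner 𝕜 x x) := tensorForm_map_le S x
  rw [inner_self_eq_norm_sq, inner_self_eq_norm_sq] at h
  refine le_of_sq_le_sq ?_ (by positivity)
  calc ‖mapₗ S d x‖ ^ 2 ≤ (‖S‖ ^ 2) ^ d * ‖x‖ ^ 2 := h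
    _ = (‖S‖ ^ d * ‖x‖) ^ 2 := by ring

theorem norm_permuteₗ (π : Equiv.Perm (Fin d)) (x : FormalTensor 𝕜 H d) :
    ‖permuteₗ π x‖ = ‖x‖ := by
  have e1 : (inner 𝕜 (permuteₗ π x) (permuteₗ π x) : 𝕜) = inner 𝕜 x x :=
    tensorForm_permute π x
  rw [← sq_eq_sq₀ (norm_nonneg _) (norm_nonneg _), ← inner_self_eq_norm_sq (𝕜 := 𝕜), e1,
    inner_self_eq_norm_sq]

end FormalTensor

/-- The Hilbert space `H_d = H ⊗ ⋯ ⊗ H` (`d` factors): the completion of the finite linear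
combinations of formal simple tensors for the form `⟪⊗ f_l, ⊗ g_l⟫ = ∏ l, ⟪f_l, g_l⟫`
(the completion identifies vectors at distance zero). -/
abbrev HilbertTensorPower (𝕜 H : Type*) [RCLike 𝕜] [NormedAddCommGroup H] [InnerProductSpace 𝕜 H]
    (d : ℕ) : Type _ := UniformSpace.Completion (FormalTensor 𝕜 H d)

namespace HilbertTensorPower

variable {𝕜 H G : Type*} [RCLike 𝕜] [NormedAddCommGroup H] [InnerProductSpace 𝕜 H]
  [NormedAddCommGroup G] [InnerProductSpace 𝕜 G] {d : ℕ}

variable (𝕜) in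
/-- The simple tensor `f₁ ⊗ ⋯ ⊗ f_d`. -/
def pure (f : Fin d → H) : HilbertTensorPower 𝕜 H d :=
  ((FormalTensor.single f : FormalTensor 𝕜 H d) : UniformSpace.Completion (FormalTensor 𝕜 H d))

theorem inner_pure (f g : Fin d → H) :
    inner 𝕜 (pure 𝕜 f) (pure 𝕜 g) = ∏ l, inner 𝕜 (f l) (g l) := by
  rw [pure, pure, UniformSpace.Completion.inner_coe, FormalTensor.inner_single]

theorem dense_span_pure :
    Dense (Submodule.span 𝕜 (Set.range (pure 𝕜 : (Fin d → H) → HilbertTensorPower 𝕜 H d)) :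
      Set (HilbertTensorPower 𝕜 H d)) := by
  refine UniformSpace.Completion.denseRange_coe.mono ?_
  rintro _ ⟨x, rfl⟩
  have hadd : ∀ x y : FormalTensor 𝕜 H d,
      (x : UniformSpace.Completion (FormalTensor 𝕜 H d)) ∈ Submodule.span 𝕜
        (Set.range (pure 𝕜 : (Fin d → H) → HilbertTensorPower 𝕜 H d)) →
      (y : UniformSpace.Completion (FormalTensor 𝕜 H d)) ∈ Submodule.span 𝕜
        (Set.range (pure 𝕜 : (Fin d → H) → HilbertTensorPower 𝕜 H d)) →
      ((x + y : FormalTensor 𝕜 H d) : UniformSpace.Completion (FormalTensor 𝕜 H d)) ∈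
        Submodule.span 𝕜 (Set.range (pure 𝕜 : (Fin d → H) → HilbertTensorPower 𝕜 H d)) := by
    intro x y hx hy
    rw [UniformSpace.Completion.coe_add]
    exact Submodule.add_mem _ hx hy
  refine Finsupp.induction_linear (motive := fun x : (Fin d → H) →₀ 𝕜 =>
    UniformSpace.Completion.coe' (α := FormalTensor 𝕜 H d) x ∈
      Submodule.span 𝕜 (Set.range (pure 𝕜 : (Fin d → H) → HilbertTensorPower 𝕜 H d))) x ?_ ?_ ?_
  · exact Submodule.zero_mem _
  · intro x y hx hy
    exact hadd x y hx hy
  · intro f a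
    have h := Submodule.smul_mem _ a (Submodule.subset_span (R := 𝕜)
      (Set.mem_range_self (f := (pure 𝕜 : (Fin d → H) → HilbertTensorPower 𝕜 H d)) f))
    rw [pure, ← UniformSpace.Completion.coe_smul] at h
    have e : a • (FormalTensor.single f : FormalTensor 𝕜 H d) =
        (Finsupp.single f a : (Fin d → H) →₀ 𝕜) := Finsupp.smul_single_one f a
    rw [e] at h
    exact h

/-- The tensor product operator `S ⊗ ⋯ ⊗ S : H_d → G_d`. -/
def map (S : H →L[𝕜] G) (d : ℕ) : HilbertTensorPower 𝕜 H d →L[𝕜] HilbertTensorPower 𝕜 G d :=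
  ((FormalTensor.mapₗ S d).mkContinuous (‖S‖ ^ d) (FormalTensor.norm_mapₗ_le S)).completion

theorem map_pure (S : H →L[𝕜] G) (f : Fin d → H) :
    map S d (pure 𝕜 f) = pure 𝕜 fun l => S (f l) := by
  rw [map, pure, ContinuousLinearMap.completion_apply_coe, LinearMap.mkContinuous_apply,
    FormalTensor.mapₗ_single, pure]

variable (𝕜 H) in
/-- The operator on `H_d` with `f₁ ⊗ ⋯ ⊗ f_d ↦ f_{π(1)} ⊗ ⋯ ⊗ f_{π(d)}`. -/
def permute (π : Equiv.Perm (Fin d)) : HilbertTensorPower 𝕜 H d →L[𝕜] HilbertTensorPower 𝕜 H d :=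
  ((FormalTensor.permuteₗ π).mkContinuous 1
    fun x => by rw [FormalTensor.norm_permuteₗ, one_mul]).completion

theorem permute_pure (π : Equiv.Perm (Fin d)) (f : Fin d → H) :
    permute 𝕜 H π (pure 𝕜 f) = pure 𝕜 fun l => f (π l) := by
  rw [permute, pure, ContinuousLinearMap.completion_apply_coe, LinearMap.mkContinuous_apply,
    FormalTensor.permuteₗ_single, pure]

end HilbertTensorPower

end TensorPower

/-! ### Antisymmetric subspaces -/

/-- The permutations of the coordinates that fix every coordinate outside `I`. -/
def permsFixingCompl {d : ℕ} (I : Finset (Fin d)) : Finset (Equiv.Perm (Fin d)) :=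
  Finset.univ.filter fun π => ∀ i, i ∉ I → π i = i

/-- The antisymmetrizer on `H_d` with respect to the coordinates in `I`:
`(1 / #S_I) ∑_{π ∈ S_I} sign(π) π`. -/
def antisymmetrizer (𝕜 H : Type*) [RCLike 𝕜] [NormedAddCommGroup H] [InnerProductSpace 𝕜 H]
    {d : ℕ} (I : Finset (Fin d)) : HilbertTensorPower 𝕜 H d →L[𝕜] HilbertTensorPower 𝕜 H d :=
  ((permsFixingCompl I).card : 𝕜)⁻¹ • ∑ π ∈ permsFixingCompl I,
    ((Equiv.Perm.sign π : ℤ) : 𝕜) • HilbertTensorPower.permute 𝕜 H π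

/-- The subspace of `I`-antisymmetric elements of `H_d`: the range of the antisymmetrizer. -/
def antisymmetricSubspace (𝕜 H : Type*) [RCLike 𝕜] [NormedAddCommGroup H] [InnerProductSpace 𝕜 H]
    {d : ℕ} (I : Finset (Fin d)) : Submodule 𝕜 (HilbertTensorPower 𝕜 H d) :=
  LinearMap.range (antisymmetrizer 𝕜 H I).toLinearMap

/-- The `I`-antisymmetric problem: the restriction of `S ⊗ ⋯ ⊗ S` to the `I`-antisymmetric
subspace. -/
def antisymmetricProblem {𝕜 H G : Type*} [RCLike 𝕜] [NormedAddCommGroup H] [InnerProductSpace 𝕜 H]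
    [NormedAddCommGroup G] [InnerProductSpace 𝕜 G] (S : H →L[𝕜] G) {d : ℕ} (I : Finset (Fin d)) :
    antisymmetricSubspace 𝕜 H I →L[𝕜] HilbertTensorPower 𝕜 G d :=
  (HilbertTensorPower.map S d).comp (antisymmetricSubspace 𝕜 H I).subtypeL

/-! ### Algorithms, errors, information complexity -/

/-- An algorithm that uses adaptively chosen continuous linear functionals. If `y` is the list of
the values observed so far, then `info y` is the functional evaluated next; `recon` turns the list
of all observed values into an output. -/
structure AdaptiveAlgorithm (𝕜 F G : Type*) [RCLike 𝕜] [NormedAddCommGroup F] [NormedSpace 𝕜 F] where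
  info : List 𝕜 → (F →L[𝕜] 𝕜)
  recon : List 𝕜 → G

namespace AdaptiveAlgorithm

variable {𝕜 F G : Type*} [RCLike 𝕜] [NormedAddCommGroup F] [NormedSpace 𝕜 F]

/-- The list of the first `n` observed values for the input `f`. -/
def observe (A : AdaptiveAlgorithm 𝕜 F G) (f : F) : ℕ → List 𝕜
  | 0 => []
  | n + 1 => A.observe f n ++ [A.info (A.observe f n) f]

/-- The output for the input `f` after `n` evaluations of functionals. -/
def output (A : AdaptiveAlgorithm 𝕜 F G) (n : ℕ) (f : F) : G := A.recon (A.observe f n)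

end AdaptiveAlgorithm

section Complexity

variable {𝕜 F G : Type*} [RCLike 𝕜] [NormedAddCommGroup F] [NormedSpace 𝕜 F]
  [NormedAddCommGroup G] [NormedSpace 𝕜 G]

/-- The worst case error over the unit ball of `F`, with `n` evaluations of functionals. -/
def worstCaseError (T : F →L[𝕜] G) (A : AdaptiveAlgorithm 𝕜 F G) (n : ℕ) : ℝ≥0∞ :=
  ⨆ f : F, ⨆ _ : ‖f‖ ≤ 1, ‖A.output n f - T f‖ₑ

/-- The `n`-th minimal error `e(n)`. -/
def minimalError (T : F →L[𝕜] G) (n : ℕ) : ℝ≥0∞ :=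
  ⨅ A : AdaptiveAlgorithm 𝕜 F G, worstCaseError T A n

/-- The initial error `e(0)`. -/
def initialError (T : F →L[𝕜] G) : ℝ≥0∞ := minimalError T 0

/-- The information complexity `min {n | e(n) ≤ ε}` (infinite if there is no such `n`). -/
def informationComplexity (T : F →L[𝕜] G) (ε : ℝ≥0∞) : ℕ∞ :=
  ⨅ n : ℕ, ⨅ _ : minimalError T n ≤ ε, (n : ℕ∞)

end Complexity

section Tractability

variable {𝕜 : Type*} {F G : ℕ → Type*} [RCLike 𝕜]
  [∀ d, NormedAddCommGroup (F d)] [∀ d, NormedSpace 𝕜 (F d)]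
  [∀ d, NormedAddCommGroup (G d)] [∀ d, NormedSpace 𝕜 (G d)]

/-- Polynomial tractability of `{T d}_{d ≥ 1}` with the constants `C, p, q`, for the normalized
error criterion in the worst case setting. -/
def IsPolyTractableNormalizedWith (T : ∀ d, F d →L[𝕜] G d) (C p q : ℝ) : Prop :=
  0 < C ∧ 0 < p ∧ 0 ≤ q ∧ ∀ d : ℕ, 1 ≤ d → ∀ ε : ℝ, 0 < ε → ε ≤ 1 →
    (informationComplexity (T d) (ENNReal.ofReal ε * initialError (T d)) : ℝ≥0∞) ≤
      ENNReal.ofReal (C * ε ^ (-p) * (d : ℝ) ^ q)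

/-- Strong polynomial tractability for the normalized error criterion: the exponent of `d` can be
chosen to be zero. -/
def IsStronglyPolyTractableNormalized (T : ∀ d, F d →L[𝕜] G d) : Prop :=
  ∃ C p : ℝ, IsPolyTractableNormalizedWith T C p 0

end Tractability

/-! ### The sequence of eigenvalues -/

/-- `lam` is the non-increasing sequence of the eigenvalues of the (compact, positive) operator `W`,
repeated according to multiplicity: there are orthonormal eigenvectors for the positive entries, and
`W` vanishes on their orthogonal complement. (If `W` has finite rank, then the sequence ends with
zeros; if it has infinite rank, then a possible eigenvalue zero is not listed.) -/
def IsEigenvalueSequence {𝕜 H : Type*} [RCLike 𝕜] [NormedAddCommGroup H] [InnerProductSpace 𝕜 H]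
    (W : H →L[𝕜] H) (lam : ℕ → ℝ) : Prop :=
  Antitone lam ∧ (∀ m, 0 ≤ lam m) ∧
    ∃ e : {m : ℕ // 0 < lam m} → H, Orthonormal 𝕜 e ∧
      (∀ m, W (e m) = (lam m : 𝕜) • e m) ∧
      ∀ x : H, (∀ m, inner 𝕜 (e m) x = 0) → W x = 0

end

/-! The eigenvectors of `S†S` give an orthonormal family of simple tensors. Antisymmetrizing on `I`
kills those with a repeated index on `I`. The others yield one eigenvector per orbit under
permutations of `I`, with squared singular value the product of the eigenvalues involved. The
largest such product is at most `L = maxEigenvalue lam I`: the top `#I` eigenvalues on `I`, and `lam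
0` at every free coordinate. Hence the initial error is at most `√L`
(`IsSingularFamily.norm_map_le`).

Conversely, `N` such tensors with squared singular value at least `L * r` force `e(n) ≥ √(L * r)`
for `n < N`: an adaptive algorithm cannot separate `f` from `-f` when all its data vanish
(`le_minimalError_of_finrank`). Tractability then bounds the count, `N ≤ C 2^p r^(-p/2) d^q`
(`IsPolyTractableNormalizedWith.card_le`). An upper bound for the initial error suffices here.

The count is used twice. For `d = 1` it gives `lam n = O(n^(-2/p))`, hence summability. For general
`d`, move `i` of the `b` free coordinates from `lam 0` to `lam 1`. This bounds `b.choose i` by `R^i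
d^q` up to a constant, and summing with geometric weights gives `(1 + s)^b ≤ K d^q`. So `b` is at
most logarithmic, and bounded when `q = 0`. Finally, `lam` tends to zero and almost all coordinates
are antisymmetric, so `√L` decays exponentially in `d`. -/

/-! ### Simple tensors determine functionals and operators -/

namespace HilbertTensorPower

variable {𝕜 H G X : Type*} [RCLike 𝕜] [NormedAddCommGroup H] [InnerProductSpace 𝕜 H]
  [NormedAddCommGroup G] [InnerProductSpace 𝕜 G] [NormedAddCommGroup X] [InnerProductSpace 𝕜 X]
  {d : ℕ}

theorem clm_ext {f g : HilbertTensorPower 𝕜 H d →L[𝕜] X}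
    (h : ∀ v, f (pure 𝕜 v) = g (pure 𝕜 v)) : f = g :=
  ContinuousLinearMap.ext_on dense_span_pure (by rintro _ ⟨v, rfl⟩; exact h v)

theorem ext_inner_pure {x y : HilbertTensorPower 𝕜 H d}
    (h : ∀ v, inner 𝕜 x (pure 𝕜 v) = inner 𝕜 y (pure 𝕜 v)) : x = y := by
  have h1 : innerSL 𝕜 x = innerSL 𝕜 y := clm_ext fun v => by simpa using h v
  exact ext_inner_right 𝕜 fun v => by simpa using congrArg (fun φ => φ v) h1

/-- The adjoint of a permutation operator is that of the inverse permutation, by reindexing the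
product of inner products. -/
theorem inner_pure_permute (π : Equiv.Perm (Fin d)) (v : Fin d → H)
    (x : HilbertTensorPower 𝕜 H d) :
    inner 𝕜 (pure 𝕜 v) (permute 𝕜 H π x) = inner 𝕜 (pure 𝕜 fun l => v (π⁻¹ l)) x := by
  have h1 : (innerSL 𝕜 (pure 𝕜 v)).comp (permute 𝕜 H π) =
      innerSL 𝕜 (pure 𝕜 fun l => v (π⁻¹ l)) := clm_ext fun w => by
    simp only [ContinuousLinearMap.comp_apply, innerSL_apply_apply, permute_pure, inner_pure]
    rw [← Equiv.prod_comp π (fun l => (inner 𝕜 (v (π⁻¹ l)) (w l) : 𝕜))]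
    simp
  simpa using congrArg (fun φ => φ x) h1

/-- The hypothesis is the weak form, without adjoints, of each `v l` being an eigenvector of `S†S`.
It multiplies over the factors of simple tensors and extends by density. -/
theorem inner_map_pure_map (S : H →L[𝕜] G) (v : Fin d → H) (c : Fin d → 𝕜)
    (h : ∀ l x, inner 𝕜 (S (v l)) (S x) = c l * inner 𝕜 (v l) x)
    (x : HilbertTensorPower 𝕜 H d) :
    inner 𝕜 (map S d (pure 𝕜 v)) (map S d x) = (∏ l, c l) * inner 𝕜 (pure 𝕜 v) x := by
  have h1 : (innerSL 𝕜 (map S d (pure 𝕜 v))).comp (map S d) =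
      (∏ l, c l) • innerSL 𝕜 (pure 𝕜 v) := clm_ext fun w => by
    simp [map_pure, inner_pure, h, Finset.prod_mul_distrib]
  simpa using congrArg (fun φ => φ x) h1

/-- The simple tensor as a function of one of its factors. -/
noncomputable def pureUpdate (v : Fin d → H) (l : Fin d) : H →L[𝕜] HilbertTensorPower 𝕜 H d :=
  LinearMap.mkContinuous
    { toFun := fun x => pure 𝕜 (Function.update v l x)
      map_add' := fun x y => ext_inner_pure fun w => by
        simp only [inner_add_left, inner_pure]
        rw [Fintype.prod_eq_mul_prod_compl l, Fintype.prod_eq_mul_prod_compl l,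
          Fintype.prod_eq_mul_prod_compl l]
        have hc : ∀ z, ∏ i ∈ {l}ᶜ, (inner 𝕜 (Function.update v l z i) (w i) : 𝕜)
            = ∏ i ∈ {l}ᶜ, inner 𝕜 (v i) (w i) := fun z =>
          Finset.prod_congr rfl fun i hi => by
            rw [Function.update_of_ne (by simpa using hi)]
        simp only [hc, Function.update_self, inner_add_left, add_mul]
      map_smul' := fun a x => ext_inner_pure fun w => by
        simp only [inner_smul_left, inner_pure, RingHom.id_apply]
        rw [Fintype.prod_eq_mul_prod_compl l, Fintype.prod_eq_mul_prod_compl l]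
        have hc : ∀ z, ∏ i ∈ {l}ᶜ, (inner 𝕜 (Function.update v l z i) (w i) : 𝕜)
            = ∏ i ∈ {l}ᶜ, inner 𝕜 (v i) (w i) := fun z =>
          Finset.prod_congr rfl fun i hi => by
            rw [Function.update_of_ne (by simpa using hi)]
        simp only [hc, Function.update_self, inner_smul_left, mul_assoc] }
    (∏ i ∈ {l}ᶜ, ‖v i‖) fun x => by
      refine le_of_sq_le_sq ?_ (by positivity)
      have h : (inner 𝕜 (pure 𝕜 (Function.update v l x)) (pure 𝕜 (Function.update v l x)) : 𝕜)
          = (((∏ i ∈ {l}ᶜ, ‖v i‖) * ‖x‖) ^ 2 : ℝ) := by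
        rw [inner_pure, Fintype.prod_eq_mul_prod_compl l]
        have hc : ∏ i ∈ {l}ᶜ, (inner 𝕜 (Function.update v l x i) (Function.update v l x i) : 𝕜)
            = ∏ i ∈ {l}ᶜ, inner 𝕜 (v i) (v i) :=
          Finset.prod_congr rfl fun i hi => by
            rw [Function.update_of_ne (by simpa using hi)]
        rw [hc]
        simp only [Function.update_self, inner_self_eq_norm_sq_to_K]
        push_cast
        rw [Finset.prod_pow]
        ring
      rw [inner_self_eq_norm_sq_to_K] at h
      exact le_of_eq (by exact_mod_cast h)

theorem pureUpdate_apply (v : Fin d → H) (l : Fin d) (x : H) :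
    pureUpdate (𝕜 := 𝕜) v l x = pure 𝕜 (Function.update v l x) := rfl

/-- Simple tensors with factors in the closed span of a family lie in the closed span of the simple
tensors of members of the family. -/
theorem pure_mem_closure_span {ι : Type*} (u : ι → H) (v : Fin d → H)
    (hv : ∀ l, v l ∈ (Submodule.span 𝕜 (Set.range u)).topologicalClosure) :
    pure 𝕜 v ∈ (Submodule.span 𝕜 (Set.range fun j : Fin d → ι =>
      pure 𝕜 fun l => u (j l))).topologicalClosure := by
  set V := (Submodule.span 𝕜 (Set.range fun j : Fin d → ι =>
      pure 𝕜 fun l => u (j l))).topologicalClosure with hV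
  -- Factors are released one at a time: those in `s` may lie in the closed span, the others still
  -- belong to the family. Continuity of `pureUpdate` in one factor gives the induction step.
  have key : ∀ s : Finset (Fin d), ∀ v : Fin d → H,
      (∀ l ∈ s, v l ∈ (Submodule.span 𝕜 (Set.range u)).topologicalClosure) →
      (∀ l ∉ s, v l ∈ Set.range u) → pure 𝕜 v ∈ V := by
    intro s
    induction s using Finset.induction_on with
    | empty =>
      intro v _ h2
      choose j hj using fun l => h2 l (by simp)
      refine Submodule.le_topologicalClosure _ (Submodule.subset_span ⟨j, ?_⟩)
      simp [hj]
    | insert i s hi ih =>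
      intro v h1 h2
      have hle : (Submodule.span 𝕜 (Set.range u)).topologicalClosure ≤
          V.comap (pureUpdate (𝕜 := 𝕜) v i).toLinearMap := by
        refine Submodule.topologicalClosure_minimal _ ?_ ?_
        · rw [Submodule.span_le]
          rintro _ ⟨k, rfl⟩
          change pureUpdate (𝕜 := 𝕜) v i (u k) ∈ V
          rw [pureUpdate_apply]
          refine ih _ (fun l hl => ?_) fun l hl => ?_
          · rw [Function.update_of_ne (by rintro rfl; exact hi hl)]
            exact h1 l (Finset.mem_insert_of_mem hl)
          · by_cases h : l = i
            · subst h; simp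
            · rw [Function.update_of_ne h]
              exact h2 l (by simp [h, hl])
        · exact (Submodule.isClosed_topologicalClosure _).preimage
            (pureUpdate (𝕜 := 𝕜) v i).continuous
      have h3 : pureUpdate (𝕜 := 𝕜) v i (v i) ∈ V := hle (h1 i (Finset.mem_insert_self _ _))
      rwa [pureUpdate_apply, Function.update_eq_self] at h3
  exact key Finset.univ v (fun l _ => hv l) (by simp)

end HilbertTensorPower

/-! ### Lower bounds for adaptive algorithms -/

section LowerBound

variable {𝕜 F G : Type*} [RCLike 𝕜] [NormedAddCommGroup F] [NormedSpace 𝕜 F]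
  [NormedAddCommGroup G] [NormedSpace 𝕜 G]

/-- Along the branch where every answer is zero the functionals are fixed in advance, so adaptivity
gives no advantage there. -/
theorem AdaptiveAlgorithm.observe_eq_replicate (A : AdaptiveAlgorithm 𝕜 F G) (f : F) (n : ℕ)
    (h : ∀ k < n, A.info (List.replicate k 0) f = 0) : A.observe f n = List.replicate n 0 := by
  induction n with
  | zero => rfl
  | succ n ih =>
    rw [AdaptiveAlgorithm.observe, ih fun k hk => h k (by omega), h n (by omega),
      List.replicate_succ']

/-- The `n` functionals of the zero branch have a common nonzero zero in `V`, as its dimension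
exceeds `n`. Its normalization `g` and `-g` get the same output, which cannot be close to both `T g`
and `-T g`. -/
theorem le_minimalError_of_finrank (T : F →L[𝕜] G) (V : Submodule 𝕜 F) [FiniteDimensional 𝕜 V]
    {n : ℕ} (hn : n < Module.finrank 𝕜 V) {s : ℝ} (hs : ∀ f ∈ V, s * ‖f‖ ≤ ‖T f‖) :
    ENNReal.ofReal s ≤ minimalError T n := by
  refine le_iInf fun A => ?_
  let L : V →ₗ[𝕜] (Fin n → 𝕜) :=
    LinearMap.pi fun k => (A.info (List.replicate k 0)).toLinearMap.comp V.subtype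
  have hker : LinearMap.ker L ≠ ⊥ := LinearMap.ker_ne_bot_of_finrank_lt (by simpa using hn)
  obtain ⟨f, hf, hf0⟩ := Submodule.exists_mem_ne_zero_of_ne_bot hker
  have hf0' : (f : F) ≠ 0 := by simpa using hf0
  have hnorm : ‖(f : F)‖ ≠ 0 := norm_ne_zero_iff.2 hf0'
  set g : F := ((‖(f : F)‖⁻¹ : ℝ) : 𝕜) • (f : F) with hg
  have hgn : ‖g‖ = 1 := by
    rw [hg, norm_smul, RCLike.norm_ofReal, abs_of_nonneg (by positivity), inv_mul_cancel₀ hnorm]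
  have hgV : g ∈ V := V.smul_mem _ f.2
  have hinfo : ∀ k < n, A.info (List.replicate k 0) g = 0 := fun k hk => by
    have h1 : A.info (List.replicate k 0) (f : F) = 0 := congrFun (LinearMap.mem_ker.1 hf) ⟨k, hk⟩
    rw [hg, map_smul, h1, smul_zero]
  have ho : A.output n g = A.output n (-g) := by
    rw [AdaptiveAlgorithm.output, AdaptiveAlgorithm.output, A.observe_eq_replicate g n hinfo,
      A.observe_eq_replicate (-g) n fun k hk => by rw [map_neg, hinfo k hk, neg_zero]]
  have hTg : s ≤ ‖T g‖ := by simpa [hgn] using hs g hgV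
  have hle : ∀ h : F, ‖h‖ ≤ 1 → ‖A.output n h - T h‖ₑ ≤ worstCaseError T A n := fun h hh =>
    le_iSup₂_of_le h hh le_rfl
  have hor : s ≤ ‖A.output n g - T g‖ ∨ s ≤ ‖A.output n (-g) - T (-g)‖ := by
    by_contra! hcon
    -- The common output cancels in the difference of the two errors, leaving `2 T g`.
    have h1 : ‖(2 : 𝕜) • T g‖ ≤ ‖A.output n (-g) - T (-g)‖ + ‖A.output n g - T g‖ := by
      refine le_trans (le_of_eq ?_) (norm_sub_le _ _)
      rw [ho, map_neg, two_smul]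
      congr 1
      abel
    rw [norm_smul, RCLike.norm_two] at h1
    linarith [hcon.1, hcon.2]
  rcases hor with h | h
  · exact (ENNReal.ofReal_le_ofReal h).trans ((ofReal_norm _).le.trans (hle g hgn.le))
  · exact (ENNReal.ofReal_le_ofReal h).trans
      ((ofReal_norm _).le.trans (hle (-g) (by rw [norm_neg, hgn])))

theorem initialError_le (T : F →L[𝕜] G) {s : ℝ} (hs : 0 ≤ s) (h : ∀ f, ‖T f‖ ≤ s * ‖f‖) :
    initialError T ≤ ENNReal.ofReal s := by
  refine iInf_le_of_le ⟨fun _ => 0, fun _ => 0⟩ (iSup₂_le fun f hf => ?_)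
  rw [AdaptiveAlgorithm.output, zero_sub, enorm_neg, ← ofReal_norm]
  exact ENNReal.ofReal_le_ofReal ((h f).trans (mul_le_of_le_one_right hs hf))

theorem le_informationComplexity (T : F →L[𝕜] G) {ε : ℝ≥0∞} {N : ℕ}
    (h : ∀ n < N, ε < minimalError T n) : (N : ℕ∞) ≤ informationComplexity T ε :=
  le_iInf₂ fun n hn => by
    by_contra hlt
    exact absurd hn (not_le.2 (h n (by exact_mod_cast not_le.1 hlt)))

end LowerBound

theorem norm_sum_smul_sq_of_orthogonal {𝕜 K ι : Type*} [RCLike 𝕜] [NormedAddCommGroup K]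
    [InnerProductSpace 𝕜 K] (t : Finset ι) (y : ι → K)
    (hy : ∀ i k, i ≠ k → inner 𝕜 (y i) (y k) = 0) (c : ι → 𝕜) :
    ‖∑ i ∈ t, c i • y i‖ ^ 2 = ∑ i ∈ t, ‖c i‖ ^ 2 * ‖y i‖ ^ 2 := by
  rw [← RCLike.ofReal_inj (K := 𝕜), RCLike.ofReal_pow, ← inner_self_eq_norm_sq_to_K, sum_inner]
  push_cast
  refine Finset.sum_congr rfl fun i hi => ?_
  rw [inner_sum, Finset.sum_eq_single i]
  · rw [inner_smul_left, inner_smul_right, inner_self_eq_norm_sq_to_K, ← mul_assoc,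
      RCLike.conj_mul]
  · intro k _ hk
    rw [inner_smul_left, inner_smul_right, hy i k hk.symm, mul_zero, mul_zero]
  · exact fun h => absurd hi h

/-- Lower bound for the minimal errors by orthogonal vectors with orthogonal images. -/
theorem le_minimalError_of_orthogonal {𝕜 F G ι : Type*} [RCLike 𝕜] [NormedAddCommGroup F]
    [InnerProductSpace 𝕜 F] [NormedAddCommGroup G] [InnerProductSpace 𝕜 G] [Fintype ι]
    (T : F →L[𝕜] G) (x : ι → F) (hx0 : ∀ i, x i ≠ 0)
    (hx : ∀ i k, i ≠ k → inner 𝕜 (x i) (x k) = 0)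
    (hTx : ∀ i k, i ≠ k → inner 𝕜 (T (x i)) (T (x k)) = 0)
    {s : ℝ} (hs0 : 0 ≤ s) (hs : ∀ i, s * ‖x i‖ ≤ ‖T (x i)‖) {n : ℕ} (hn : n < Fintype.card ι) :
    ENNReal.ofReal s ≤ minimalError T n := by
  classical
  have hli : LinearIndependent 𝕜 x := linearIndependent_of_ne_zero_of_inner_eq_zero hx0 hx
  have := FiniteDimensional.span_of_finite 𝕜 (Set.finite_range x)
  refine le_minimalError_of_finrank T (Submodule.span 𝕜 (Set.range x))
    (by rwa [finrank_span_eq_card hli]) fun f hf => ?_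
  obtain ⟨c, rfl⟩ := (Submodule.mem_span_range_iff_exists_fun 𝕜).1 hf
  refine le_of_sq_le_sq ?_ (norm_nonneg _)
  rw [map_sum]
  simp only [map_smul]
  rw [mul_pow, norm_sum_smul_sq_of_orthogonal _ x hx c,
    norm_sum_smul_sq_of_orthogonal _ (fun i => T (x i)) hTx c, Finset.mul_sum]
  refine Finset.sum_le_sum fun i _ => ?_
  have h1 : (s * ‖x i‖) ^ 2 ≤ ‖T (x i)‖ ^ 2 := pow_le_pow_left₀ (by positivity) (hs i) 2
  nlinarith [mul_le_mul_of_nonneg_left h1 (sq_nonneg ‖c i‖)]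

/-! ### Permutations and antisymmetric tensors -/

section Antisymmetric

open HilbertTensorPower

variable {𝕜 H G : Type*} [RCLike 𝕜] [NormedAddCommGroup H] [InnerProductSpace 𝕜 H]
  [NormedAddCommGroup G] [InnerProductSpace 𝕜 G] {d : ℕ}

theorem mem_permsFixingCompl {I : Finset (Fin d)} {π : Equiv.Perm (Fin d)} :
    π ∈ permsFixingCompl I ↔ ∀ i, i ∉ I → π i = i := by simp [permsFixingCompl]

theorem inv_mem_permsFixingCompl {I : Finset (Fin d)} {π : Equiv.Perm (Fin d)}
    (h : π ∈ permsFixingCompl I) : π⁻¹ ∈ permsFixingCompl I := by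
  rw [mem_permsFixingCompl] at *
  intro i hi
  rw [Equiv.Perm.inv_eq_iff_eq, h i hi]

theorem mul_mem_permsFixingCompl {I : Finset (Fin d)} {π σ : Equiv.Perm (Fin d)}
    (h : π ∈ permsFixingCompl I) (h' : σ ∈ permsFixingCompl I) : π * σ ∈ permsFixingCompl I := by
  rw [mem_permsFixingCompl] at *
  intro i hi
  rw [Equiv.Perm.mul_apply, h' i hi, h i hi]

theorem mem_of_mem_permsFixingCompl {I : Finset (Fin d)} {π : Equiv.Perm (Fin d)}
    (h : π ∈ permsFixingCompl I) {i : Fin d} (hi : i ∈ I) : π i ∈ I := by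
  by_contra hc
  have h1 := mem_permsFixingCompl.1 h (π i) hc
  exact hc (by rwa [π.injective h1])

theorem card_permsFixingCompl_ne_zero (I : Finset (Fin d)) : ((permsFixingCompl I).card : 𝕜) ≠ 0 := by
  rw [Nat.cast_ne_zero, Finset.card_ne_zero]
  exact ⟨1, by simp [permsFixingCompl]⟩

theorem antisymmetrizer_apply (I : Finset (Fin d)) (x : HilbertTensorPower 𝕜 H d) :
    antisymmetrizer 𝕜 H I x = ((permsFixingCompl I).card : 𝕜)⁻¹ • ∑ π ∈ permsFixingCompl I,
      ((Equiv.Perm.sign π : ℤ) : 𝕜) • permute 𝕜 H π x := by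
  simp [antisymmetrizer]

/-- Antisymmetric tensors are orthogonal to simple tensors with two equal antisymmetrized factors. -/
theorem inner_pure_eq_zero_of_mem_antisymmetricSubspace {I : Finset (Fin d)} {v : Fin d → H}
    {k l : Fin d} (hk : k ∈ I) (hl : l ∈ I) (hkl : k ≠ l) (hv : v k = v l)
    {f : HilbertTensorPower 𝕜 H d} (hf : f ∈ antisymmetricSubspace 𝕜 H I) :
    inner 𝕜 (pure 𝕜 v) f = 0 := by
  obtain ⟨g, rfl⟩ := hf
  change inner 𝕜 (pure 𝕜 v) (antisymmetrizer 𝕜 H I g) = 0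
  rw [antisymmetrizer_apply, inner_smul_right, inner_sum]
  refine mul_eq_zero_of_right _ ?_
  have hswap : Equiv.swap k l ∈ permsFixingCompl I := mem_permsFixingCompl.2 fun i hi =>
    Equiv.swap_apply_of_ne_of_ne (by rintro rfl; exact hi hk) (by rintro rfl; exact hi hl)
  have hvs : ∀ i, v (Equiv.swap k l i) = v i := fun i => by
    rcases eq_or_ne i k with rfl | h1
    · rw [Equiv.swap_apply_left, hv]
    rcases eq_or_ne i l with rfl | h2
    · rw [Equiv.swap_apply_right, hv]
    rw [Equiv.swap_apply_of_ne_of_ne h1 h2]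
  -- Composing with the transposition leaves `v` unchanged and flips the sign, so the terms cancel
  -- in pairs.
  refine Finset.sum_involution (fun π _ => π * Equiv.swap k l) (fun π _ => ?_) (fun π _ _ h => ?_)
    (fun π hπ => mul_mem_permsFixingCompl hπ hswap) (fun π _ => ?_)
  · rw [inner_smul_right, inner_smul_right, inner_pure_permute, inner_pure_permute]
    simp only [mul_inv_rev, Equiv.swap_inv, Equiv.Perm.mul_apply, hvs]
    rw [Equiv.Perm.sign_mul, Equiv.Perm.sign_swap hkl]
    push_cast
    ring
  · exact hkl (Equiv.swap_eq_one_iff.1 (mul_eq_left.1 h))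
  · rw [mul_assoc, Equiv.swap_mul_self, mul_one]

end Antisymmetric

/-! ### Singular values of the antisymmetric problem -/

section Eigen

open HilbertTensorPower

variable {𝕜 H G M : Type*} [RCLike 𝕜] [NormedAddCommGroup H] [InnerProductSpace 𝕜 H]
  [NormedAddCommGroup G] [InnerProductSpace 𝕜 G] {d : ℕ}

/-- The singular value relations of an orthonormal family `e`, with `S` vanishing on
the orthogonal complement of the family. -/
structure IsSingularFamily (S : H →L[𝕜] G) (e : M → H) (mu : M → ℝ) : Prop where
  orthonormal : Orthonormal 𝕜 e
  pos : ∀ m, 0 < mu m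
  inner_map : ∀ m x, inner 𝕜 (S (e m)) (S x) = (mu m : 𝕜) * inner 𝕜 (e m) x
  map_eq_zero : ∀ x, (∀ m, inner 𝕜 (e m) x = 0) → S x = 0

variable (𝕜) in
/-- The simple tensors of members of a family. -/
noncomputable def pureFamily (e : M → H) (j : Fin d → M) : HilbertTensorPower 𝕜 H d :=
  pure 𝕜 fun l => e (j l)

theorem orthonormal_pureFamily {e : M → H} (he : Orthonormal 𝕜 e) :
    Orthonormal 𝕜 (pureFamily 𝕜 e : (Fin d → M) → HilbertTensorPower 𝕜 H d) := by
  classical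
  rw [orthonormal_iff_ite] at he ⊢
  intro j k
  rw [pureFamily, pureFamily, inner_pure]
  simp only [he]
  by_cases h : j = k
  · subst h; simp
  · rw [if_neg h]
    obtain ⟨l, hl⟩ := Function.ne_iff.1 h
    exact Finset.prod_eq_zero (Finset.mem_univ l) (if_neg hl)

namespace IsSingularFamily

variable {S : H →L[𝕜] G} {e : M → H} {mu : M → ℝ}

theorem inner_map_pureFamily (h : IsSingularFamily S e mu) (j : Fin d → M)
    (x : HilbertTensorPower 𝕜 H d) :
    inner 𝕜 (map S d (pureFamily 𝕜 e j)) (map S d x) =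
      ((∏ l, mu (j l) : ℝ) : 𝕜) * inner 𝕜 (pureFamily 𝕜 e j) x := by
  rw [pureFamily, inner_map_pure_map S _ (fun l => (mu (j l) : 𝕜)) fun l x => h.inner_map _ _]
  push_cast
  rfl

/-- Split `x` along the closed span of `e`; completeness provides the projection, and `S` kills the
orthogonal part. -/
theorem map_mem_closure_span [CompleteSpace H] (h : IsSingularFamily S e mu) (x : H) :
    S x ∈ (Submodule.span 𝕜 (Set.range fun m => S (e m))).topologicalClosure := by
  set K := (Submodule.span 𝕜 (Set.range e)).topologicalClosure with hK
  have : CompleteSpace K := (Submodule.isClosed_topologicalClosure _).completeSpace_coe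
  obtain ⟨y, hy, z, hz, rfl⟩ := K.exists_add_mem_mem_orthogonal x
  have hSz : S z = 0 := h.map_eq_zero z fun m =>
    hz _ (Submodule.le_topologicalClosure _ (Submodule.subset_span ⟨m, rfl⟩))
  rw [map_add, hSz, add_zero]
  have hle : K ≤ (Submodule.span 𝕜 (Set.range fun m => S (e m))).topologicalClosure.comap
      S.toLinearMap := by
    refine Submodule.topologicalClosure_minimal _ ?_
      ((Submodule.isClosed_topologicalClosure _).preimage S.continuous)
    rw [Submodule.span_le]
    rintro _ ⟨m, rfl⟩
    exact Submodule.le_topologicalClosure _ (Submodule.subset_span ⟨m, rfl⟩)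
  exact hle hy

theorem map_mem_closure_span_pureFamily [CompleteSpace H] (h : IsSingularFamily S e mu)
    (x : HilbertTensorPower 𝕜 H d) :
    map S d x ∈ (Submodule.span 𝕜 (Set.range fun j : Fin d → M =>
      map S d (pureFamily 𝕜 e j))).topologicalClosure := by
  set V := (Submodule.span 𝕜 (Set.range fun j : Fin d → M =>
      map S d (pureFamily 𝕜 e j))).topologicalClosure with hV
  have hcl : IsClosed ((V.comap (map S d).toLinearMap : Submodule 𝕜 _) :
      Set (HilbertTensorPower 𝕜 H d)) :=
    (Submodule.isClosed_topologicalClosure _).preimage (map S d).continuous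
  have hle : Submodule.span 𝕜 (Set.range (pure 𝕜 : (Fin d → H) → HilbertTensorPower 𝕜 H d)) ≤
      V.comap (map S d).toLinearMap := by
    rw [Submodule.span_le]
    rintro _ ⟨v, rfl⟩
    change map S d (pure 𝕜 v) ∈ V
    rw [HilbertTensorPower.map_pure, hV]
    simp only [pureFamily, HilbertTensorPower.map_pure]
    exact pure_mem_closure_span (fun m => S (e m)) _ fun l => h.map_mem_closure_span _
  have hx := dense_span_pure (𝕜 := 𝕜) (H := H) (d := d) x
  exact hcl.closure_subset_iff.2 hle hx

/-- The squared norm of the antisymmetric problem is at most the largest product of singular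
values with distinct indices in `I`. -/
theorem norm_map_le [CompleteSpace H] (h : IsSingularFamily S e mu) {I : Finset (Fin d)} {L : ℝ}
    (hL0 : 0 ≤ L) (hL : ∀ j : Fin d → M, Set.InjOn j I → ∏ l, mu (j l) ≤ L)
    {f : HilbertTensorPower 𝕜 H d} (hf : f ∈ antisymmetricSubspace 𝕜 H I) :
    ‖map S d f‖ ≤ √L * ‖f‖ := by
  classical
  set y := map S d f with hy
  have hE := orthonormal_pureFamily (d := d) h.orthonormal
  have hzero : ∀ j : Fin d → M, ¬ Set.InjOn j I → inner 𝕜 (pureFamily 𝕜 e j) f = 0 := by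
    intro j hj
    rw [Set.InjOn] at hj
    push Not at hj
    obtain ⟨k, hk, l, hl, hkl, hne⟩ := hj
    exact inner_pure_eq_zero_of_mem_antisymmetricSubspace hk hl hne (by rw [hkl]) hf
  have hp : ∀ j : Fin d → M, 0 < ∏ l, mu (j l) := fun j => Finset.prod_pos fun l _ => h.pos _
  -- Test `y` against combinations of images of eigentensors first. Since `y` lies in their closed
  -- span, the bound then applies to `z = y` and gives `‖y‖² ≤ √L * ‖f‖ * ‖y‖`.
  have hspan : ∀ z ∈ Submodule.span 𝕜 (Set.range fun j : Fin d → M =>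
      map S d (pureFamily 𝕜 e j)), ‖(inner 𝕜 z y : 𝕜)‖ ≤ √L * ‖f‖ * ‖z‖ := by
    intro z hz
    obtain ⟨c, rfl⟩ := (Finsupp.mem_span_range_iff_exists_finsupp).1 hz
    have horth : ∀ i k : Fin d → M, i ≠ k →
        inner 𝕜 (map S d (pureFamily 𝕜 e i)) (map S d (pureFamily 𝕜 e k)) = 0 := fun i k hik => by
      rw [h.inner_map_pureFamily, hE.2 hik, mul_zero]
    have hnF : ∀ i : Fin d → M, ‖map S d (pureFamily 𝕜 e i)‖ ^ 2 = ∏ l, mu (i l) := fun i => by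
      rw [← RCLike.ofReal_inj (K := 𝕜), RCLike.ofReal_pow, ← inner_self_eq_norm_sq_to_K,
        h.inner_map_pureFamily, inner_self_eq_norm_sq_to_K, hE.1 i]
      simp
    have hz2 := norm_sum_smul_sq_of_orthogonal c.support
      (fun i : Fin d → M => map S d (pureFamily 𝕜 e i)) horth c
    -- Bessel's inequality; antisymmetry removes the indices not injective on `I`, for which the
    -- product need not be below `L`.
    have hbess : ∑ i ∈ c.support, (∏ l, mu (i l)) * ‖(inner 𝕜 (pureFamily 𝕜 e i) f : 𝕜)‖ ^ 2
        ≤ L * ‖f‖ ^ 2 := by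
      refine le_trans ?_ (mul_le_mul_of_nonneg_left (hE.sum_inner_products_le f (s := c.support)) hL0)
      rw [Finset.mul_sum]
      refine Finset.sum_le_sum fun i _ => ?_
      by_cases hi : Set.InjOn i I
      · exact mul_le_mul_of_nonneg_right (hL i hi) (by positivity)
      · rw [hzero i hi]; simp
    -- Each eigenvalue is split into two square roots: one half builds `‖z‖`, the other the Bessel
    -- sum.
    have hcs := Finset.sum_mul_sq_le_sq_mul_sq c.support (fun i => ‖c i‖ * √(∏ l, mu (i l)))
      (fun i => √(∏ l, mu (i l)) * ‖(inner 𝕜 (pureFamily 𝕜 e i) f : 𝕜)‖)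
    simp only [mul_pow, Real.sq_sqrt (hp _).le] at hcs
    simp only [hnF] at hz2
    rw [Finsupp.sum] at *
    refine le_of_sq_le_sq ?_ (by positivity)
    have h1 : ‖(inner 𝕜 (∑ i ∈ c.support, c i • map S d (pureFamily 𝕜 e i)) y : 𝕜)‖ ≤
        ∑ i ∈ c.support, ‖c i‖ * √(∏ l, mu (i l)) *
          (√(∏ l, mu (i l)) * ‖(inner 𝕜 (pureFamily 𝕜 e i) f : 𝕜)‖) := by
      rw [sum_inner]
      refine (norm_sum_le _ _).trans (Finset.sum_le_sum fun i _ => le_of_eq ?_)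
      rw [inner_smul_left, hy, h.inner_map_pureFamily, norm_mul, norm_mul, RCLike.norm_conj,
        RCLike.norm_ofReal, abs_of_pos (hp i)]
      nth_rewrite 1 [← Real.mul_self_sqrt (hp i).le]
      ring
    refine (pow_le_pow_left₀ (norm_nonneg _) h1 2).trans (hcs.trans ?_)
    rw [← hz2, mul_pow, mul_pow, Real.sq_sqrt hL0, mul_comm]
    exact mul_le_mul_of_nonneg_right hbess (by positivity)
  have hclosed : IsClosed {z : HilbertTensorPower 𝕜 G d |
      ‖(inner 𝕜 z y : 𝕜)‖ ≤ √L * ‖f‖ * ‖z‖} :=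
    isClosed_le (by fun_prop) (by fun_prop)
  have hyy : ‖(inner 𝕜 y y : 𝕜)‖ ≤ √L * ‖f‖ * ‖y‖ :=
    hclosed.closure_subset_iff.2 hspan (h.map_mem_closure_span_pureFamily f)
  rw [inner_self_eq_norm_sq_to_K, norm_pow, RCLike.norm_ofReal, abs_norm] at hyy
  rcases (norm_nonneg y).eq_or_lt with h0 | h0
  · rw [← h0]; positivity
  · nlinarith

theorem initialError_antisymmetricProblem_le [CompleteSpace H] (h : IsSingularFamily S e mu)
    {I : Finset (Fin d)} {L : ℝ} (hL0 : 0 ≤ L)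
    (hL : ∀ j : Fin d → M, Set.InjOn j I → ∏ l, mu (j l) ≤ L) :
    initialError (antisymmetricProblem S I) ≤ ENNReal.ofReal (√L) :=
  initialError_le _ (Real.sqrt_nonneg _) fun f => h.norm_map_le hL0 hL f.2

/-- The antisymmetrized simple tensors of a singular family. -/
noncomputable def antisymFamily (_ : IsSingularFamily S e mu) (I : Finset (Fin d)) (j : Fin d → M) :
    antisymmetricSubspace 𝕜 H I :=
  ⟨antisymmetrizer 𝕜 H I (pureFamily 𝕜 e j), LinearMap.mem_range_self _ _⟩

theorem permute_pureFamily (π : Equiv.Perm (Fin d)) (j : Fin d → M) :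
    permute 𝕜 H π (pureFamily 𝕜 e j) = pureFamily 𝕜 e (j ∘ π) := permute_pure π _

theorem coe_antisymFamily (h : IsSingularFamily S e mu) (I : Finset (Fin d)) (j : Fin d → M) :
    (h.antisymFamily I j : HilbertTensorPower 𝕜 H d) =
      ((permsFixingCompl I).card : 𝕜)⁻¹ • ∑ π ∈ permsFixingCompl I,
      ((Equiv.Perm.sign π : ℤ) : 𝕜) • pureFamily 𝕜 e (j ∘ π) := by
  simp only [antisymFamily, antisymmetrizer_apply, permute_pureFamily]

/-- Pairing with the unpermuted tensor leaves only the identity term, because injectivity of `j` on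
`I` makes its stabilizer trivial. -/
theorem antisymFamily_ne_zero (h : IsSingularFamily S e mu) (I : Finset (Fin d)) {j : Fin d → M}
    (hj : Set.InjOn j I) : h.antisymFamily I j ≠ 0 := by
  classical
  intro h0
  have h1 : inner 𝕜 (pureFamily 𝕜 e j) (h.antisymFamily I j : HilbertTensorPower 𝕜 H d) = 0 := by
    rw [h0]; simp
  rw [coe_antisymFamily, inner_smul_right, inner_sum, Finset.sum_eq_single 1] at h1
  · refine card_permsFixingCompl_ne_zero (𝕜 := 𝕜) I ?_
    have h2 : inner 𝕜 (pureFamily 𝕜 e j) (pureFamily 𝕜 e j : HilbertTensorPower 𝕜 H d) = 1 := by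
      rw [inner_self_eq_norm_sq_to_K, (orthonormal_pureFamily h.orthonormal).1]; simp
    rw [inner_smul_right, Equiv.Perm.coe_one, Function.comp_id, h2] at h1
    simpa using h1
  · intro π hπ hne
    rw [inner_smul_right, (orthonormal_pureFamily h.orthonormal).2, mul_zero]
    intro heq
    refine hne (Equiv.ext fun i => ?_)
    by_cases hi : i ∈ I
    · exact (hj hi (mem_of_mem_permsFixingCompl hπ hi) (congrFun heq i)).symm
    · exact mem_permsFixingCompl.1 hπ i hi
  · exact fun h1 => absurd (by simp [permsFixingCompl]) h1

/-- Index functions in different orbits share no simple tensor in their antisymmetrizations. -/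
theorem inner_antisymFamily (h : IsSingularFamily S e mu) (I : Finset (Fin d)) {j k : Fin d → M}
    (hjk : ∀ π ∈ permsFixingCompl I, j ∘ π ≠ k) :
    inner 𝕜 (h.antisymFamily I j) (h.antisymFamily I k) = 0 := by
  rw [Submodule.coe_inner, coe_antisymFamily, coe_antisymFamily, inner_smul_left, inner_smul_right,
    sum_inner]
  rw [Finset.sum_eq_zero, mul_zero, mul_zero]
  intro π hπ
  rw [inner_sum, Finset.sum_eq_zero]
  intro σ hσ
  rw [inner_smul_left, inner_smul_right, (orthonormal_pureFamily h.orthonormal).2, mul_zero,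
    mul_zero]
  intro heq
  refine hjk (π * σ⁻¹) (mul_mem_permsFixingCompl hπ (inv_mem_permsFixingCompl hσ)) ?_
  ext l
  have := congrFun heq (σ⁻¹ l)
  simpa using this

/-- All permuted copies of a simple tensor have the same eigenvalue, so it factors out of the
antisymmetrization. -/
theorem inner_map_antisymFamily (h : IsSingularFamily S e mu) (I : Finset (Fin d)) (j : Fin d → M)
    (x : antisymmetricSubspace 𝕜 H I) :
    inner 𝕜 (antisymmetricProblem S I (h.antisymFamily I j)) (antisymmetricProblem S I x) =
      ((∏ l, mu (j l) : ℝ) : 𝕜) * inner 𝕜 (h.antisymFamily I j) x := by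
  change inner 𝕜 (map S d (h.antisymFamily I j : HilbertTensorPower 𝕜 H d))
    (map S d (x : HilbertTensorPower 𝕜 H d)) = _
  rw [Submodule.coe_inner, coe_antisymFamily, map_smul, map_sum, inner_smul_left, inner_smul_left,
    sum_inner, sum_inner, mul_left_comm]
  congr 1
  rw [Finset.mul_sum]
  refine Finset.sum_congr rfl fun π _ => ?_
  rw [map_smul, inner_smul_left, inner_smul_left, h.inner_map_pureFamily]
  have : ∏ l, mu ((j ∘ π) l) = ∏ l, mu (j l) := Equiv.prod_comp π fun l => mu (j l)
  rw [this]
  ring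

/-- Lower bound for the minimal errors of the antisymmetric problem. -/
theorem le_minimalError (h : IsSingularFamily S e mu) {I : Finset (Fin d)} {ι : Type*} [Fintype ι]
    (j : ι → Fin d → M) (hinj : ∀ i, Set.InjOn (j i) I)
    (hne : ∀ i k, i ≠ k → ∀ π ∈ permsFixingCompl I, j i ∘ π ≠ j k) {L : ℝ}
    (hL : ∀ i, L ≤ ∏ l, mu (j i l)) {n : ℕ} (hn : n < Fintype.card ι) :
    ENNReal.ofReal (√L) ≤ minimalError (antisymmetricProblem S I) n := by
  refine le_minimalError_of_orthogonal _ (fun i => h.antisymFamily I (j i))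
    (fun i => h.antisymFamily_ne_zero I (hinj i)) (fun i k hik => h.inner_antisymFamily I (hne i k hik))
    (fun i k hik => ?_) (Real.sqrt_nonneg _) (fun i => ?_) hn
  · rw [h.inner_map_antisymFamily, h.inner_antisymFamily I (hne i k hik), mul_zero]
  · have h1 := h.inner_map_antisymFamily I (j i) (h.antisymFamily I (j i))
    rw [inner_self_eq_norm_sq_to_K, inner_self_eq_norm_sq_to_K] at h1
    have h2 : ‖antisymmetricProblem S I (h.antisymFamily I (j i))‖ ^ 2 =
      (∏ l, mu (j i l)) * ‖h.antisymFamily I (j i)‖ ^ 2 := by exact_mod_cast h1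
    have hp : 0 ≤ ∏ l, mu (j i l) := Finset.prod_nonneg fun l _ => (h.pos _).le
    rw [← Real.sqrt_sq (norm_nonneg (antisymmetricProblem S I (h.antisymFamily I (j i)))), h2,
      Real.sqrt_mul hp, Real.sqrt_sq (norm_nonneg _)]
    exact mul_le_mul_of_nonneg_right (Real.sqrt_le_sqrt (hL i)) (norm_nonneg _)

end IsSingularFamily

end Eigen

/-! ### Error bounds in terms of the eigenvalue sequence -/

theorem IsEigenvalueSequence.exists_isSingularFamily {𝕜 H G : Type*} [RCLike 𝕜]
    [NormedAddCommGroup H] [InnerProductSpace 𝕜 H] [CompleteSpace H]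
    [NormedAddCommGroup G] [InnerProductSpace 𝕜 G] [CompleteSpace G] {S : H →L[𝕜] G} {lam : ℕ → ℝ}
    (h : IsEigenvalueSequence (S.adjoint ∘L S) lam) :
    ∃ e : {m : ℕ // 0 < lam m} → H, IsSingularFamily S e fun m => lam m := by
  obtain ⟨-, -, e, he, hW, h0⟩ := h
  refine ⟨e, he, fun m => m.2, fun m x => ?_, fun x hx => ?_⟩
  · rw [← ContinuousLinearMap.adjoint_inner_left, ← ContinuousLinearMap.comp_apply, hW,
      inner_smul_left, RCLike.conj_ofReal]
  · have h1 := h0 x hx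
    rw [← inner_self_eq_zero (𝕜 := 𝕜), ← ContinuousLinearMap.adjoint_inner_left,
      ← ContinuousLinearMap.comp_apply, h1, inner_zero_left]

/-- Remove the maximum `a` of the set: the remaining elements lie below `a`, so there are at most
`a` of them, and `lam a` is at most the last factor on the right. -/
theorem Antitone.prod_le_prod_range {lam : ℕ → ℝ} (hanti : Antitone lam) (h0 : ∀ m, 0 ≤ lam m)
    (T : Finset ℕ) : ∏ t ∈ T, lam t ≤ ∏ i ∈ Finset.range T.card, lam i := by
  induction T using Finset.induction_on_max with
  | empty => simp
  | insert a T hlt ih =>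
    have ha : a ∉ T := fun h => lt_irrefl _ (hlt a h)
    rw [Finset.prod_insert ha, Finset.card_insert_of_notMem ha, Finset.prod_range_succ, mul_comm]
    refine mul_le_mul ih (hanti ?_) (h0 _) (Finset.prod_nonneg fun i _ => h0 i)
    calc T.card ≤ (Finset.range a).card :=
          Finset.card_le_card fun t ht => Finset.mem_range.2 (hlt t ht)
      _ = a := Finset.card_range a

/-- The largest product of `d` eigenvalues whose indices are distinct on `I`: the square of the
initial error of the antisymmetric problem. -/
noncomputable def maxEigenvalue (lam : ℕ → ℝ) {d : ℕ} (I : Finset (Fin d)) : ℝ :=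
  (∏ i ∈ Finset.range I.card, lam i) * lam 0 ^ Iᶜ.card

theorem prod_le_maxEigenvalue {lam : ℕ → ℝ} (hanti : Antitone lam) (h0 : ∀ m, 0 ≤ lam m) {d : ℕ}
    {I : Finset (Fin d)} {j : Fin d → ℕ} (hj : Set.InjOn j I) :
    ∏ l, lam (j l) ≤ maxEigenvalue lam I := by
  classical
  rw [← Finset.prod_mul_prod_compl I, maxEigenvalue]
  refine mul_le_mul ?_ ?_ (Finset.prod_nonneg fun i _ => h0 _) (Finset.prod_nonneg fun i _ => h0 _)
  · rw [← Finset.prod_image (f := lam) hj, ← Finset.card_image_of_injOn hj]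
    exact hanti.prod_le_prod_range h0 _
  · rw [← Finset.prod_const]
    exact Finset.prod_le_prod (fun i _ => h0 _) fun i _ => hanti (Nat.zero_le _)

section Problem

variable {𝕜 H G : Type*} [RCLike 𝕜]
  [NormedAddCommGroup H] [InnerProductSpace 𝕜 H] [CompleteSpace H]
  [NormedAddCommGroup G] [InnerProductSpace 𝕜 G] [CompleteSpace G] {S : H →L[𝕜] G} {lam : ℕ → ℝ}

theorem IsEigenvalueSequence.initialError_le (h : IsEigenvalueSequence (S.adjoint ∘L S) lam) {d : ℕ}
    (I : Finset (Fin d)) :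
    initialError (antisymmetricProblem S I) ≤ ENNReal.ofReal (√(maxEigenvalue lam I)) := by
  obtain ⟨e, he⟩ := h.exists_isSingularFamily
  refine he.initialError_antisymmetricProblem_le
    (mul_nonneg (Finset.prod_nonneg fun i _ => h.2.1 i) (pow_nonneg (h.2.1 0) _)) fun j hj => ?_
  exact prod_le_maxEigenvalue h.1 h.2.1 (j := fun l => (j l : ℕ))
    fun x hx y hy hxy => hj hx hy (Subtype.ext hxy)

theorem IsEigenvalueSequence.maxEigenvalue_pos (h : IsEigenvalueSequence (S.adjoint ∘L S) lam)
    {d : ℕ} {I : Finset (Fin d)} (hI : 0 < initialError (antisymmetricProblem S I)) :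
    0 < maxEigenvalue lam I := by
  have h1 := hI.trans_le (h.initialError_le I)
  rwa [ENNReal.ofReal_pos, Real.sqrt_pos] at h1

theorem IsEigenvalueSequence.le_minimalError (h : IsEigenvalueSequence (S.adjoint ∘L S) lam)
    {d : ℕ} {I : Finset (Fin d)} {ι : Type*} [Fintype ι] (j : ι → Fin d → ℕ)
    (hpos : ∀ i l, 0 < lam (j i l)) (hinj : ∀ i, Set.InjOn (j i) I)
    (hne : ∀ i k, i ≠ k → ∀ π ∈ permsFixingCompl I, j i ∘ π ≠ j k) {L : ℝ}
    (hL : ∀ i, L ≤ ∏ l, lam (j i l)) {n : ℕ} (hn : n < Fintype.card ι) :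
    ENNReal.ofReal (√L) ≤ minimalError (antisymmetricProblem S I) n := by
  obtain ⟨e, he⟩ := h.exists_isSingularFamily
  refine he.le_minimalError (fun i l => ⟨j i l, hpos i l⟩) (fun i x hx y hy hxy => ?_)
    (fun i k hik π hπ heq => hne i k hik π hπ ?_) hL hn
  · exact hinj i hx hy (congrArg Subtype.val hxy)
  · funext l
    exact congrArg Subtype.val (congrFun heq l)

end Problem

/-! ### Consequences of tractability -/

/-- Turns a count of singular values into an inequality between the tractability constants; `r` is
the squared singular value relative to `L`. -/
theorem IsPolyTractableNormalizedWith.card_le {𝕜 : Type*} {F G : ℕ → Type*} [RCLike 𝕜]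
    [∀ d, NormedAddCommGroup (F d)] [∀ d, NormedSpace 𝕜 (F d)]
    [∀ d, NormedAddCommGroup (G d)] [∀ d, NormedSpace 𝕜 (G d)] {T : ∀ d, F d →L[𝕜] G d} {C p q : ℝ}
    (h : IsPolyTractableNormalizedWith T C p q) {d : ℕ} (hd : 1 ≤ d) {L r : ℝ} (hL : 0 < L)
    (hr : 0 < r) (hr1 : r ≤ 1) (hinit : initialError (T d) ≤ ENNReal.ofReal (√L)) {N : ℕ}
    (hN : ∀ n < N, ENNReal.ofReal (√(L * r)) ≤ minimalError (T d) n) :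
    (N : ℝ) ≤ C * 2 ^ p * r ^ (-(p / 2)) * (d : ℝ) ^ q := by
  obtain ⟨hC, hp, hq, h⟩ := h
  have hr' : 0 < √r := Real.sqrt_pos.2 hr
  have hs1 : √r ≤ 1 := Real.sqrt_le_one.2 hr1
  -- Halving `√r` makes the threshold strictly smaller than `√(L * r)`; this is the source of the
  -- factor `2 ^ p`.
  have h1 := h d hd (√r / 2) (by positivity) (by linarith)
  have h2 : (N : ℕ∞) ≤ informationComplexity (T d)
      (ENNReal.ofReal (√r / 2) * initialError (T d)) := by
    refine le_informationComplexity _ fun n hn => lt_of_lt_of_le ?_ (hN n hn)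
    refine (mul_le_mul_right hinit _).trans_lt ?_
    rw [← ENNReal.ofReal_mul (by positivity), ENNReal.ofReal_lt_ofReal_iff (by positivity),
      Real.sqrt_mul hL.le]
    nlinarith [mul_pos hr' (Real.sqrt_pos.2 hL)]
  have h3 : ((N : ℕ∞) : ℝ≥0∞) ≤ ENNReal.ofReal (C * (√r / 2) ^ (-p) * (d : ℝ) ^ q) :=
    (ENat.toENNReal_le.2 h2).trans h1
  rw [ENat.toENNReal_coe, ← ENNReal.ofReal_natCast, ENNReal.ofReal_le_ofReal_iff (by positivity)]
    at h3
  refine h3.trans (le_of_eq ?_)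
  have h4 : (√r / 2) ^ (-p) = 2 ^ p * r ^ (-(p / 2)) := by
    rw [Real.div_rpow hr'.le zero_le_two, Real.sqrt_eq_rpow, ← Real.rpow_mul hr.le,
      Real.rpow_neg zero_le_two, div_inv_eq_mul, mul_comm]
    congr 2
    ring
  rw [h4]
  ring

section Tractable

variable {𝕜 H G : Type*} [RCLike 𝕜]
  [NormedAddCommGroup H] [InnerProductSpace 𝕜 H] [CompleteSpace H]
  [NormedAddCommGroup G] [InnerProductSpace 𝕜 G] [CompleteSpace G] {S : H →L[𝕜] G} {lam : ℕ → ℝ}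
  {I : ∀ d : ℕ, Finset (Fin d)} {C p q : ℝ}

/-- Binomial lower bound for the information complexity. -/
theorem choose_le_of_isPolyTractable (h : IsEigenvalueSequence (S.adjoint ∘L S) lam)
    (hlam2 : 0 < lam 1)
    (hT : IsPolyTractableNormalizedWith (fun d => antisymmetricProblem S (I d)) C p q)
    {d : ℕ} (hd : 1 ≤ d) (hinit : 0 < initialError (antisymmetricProblem S (I d))) (i : ℕ) :
    (((I d)ᶜ.card.choose i : ℕ) : ℝ) ≤
      C * 2 ^ p * ((lam 1 / lam 0) ^ i) ^ (-(p / 2)) * (d : ℝ) ^ q := by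
  classical
  have hlam1 : 0 < lam 0 := hlam2.trans_le (h.1 zero_le_one)
  have hpos := h.maxEigenvalue_pos hinit
  -- A zero among the top `#I` eigenvalues would make the initial error vanish.
  have hposI : ∀ k < (I d).card, 0 < lam k := fun k hk => by
    refine (h.2.1 k).lt_of_ne fun h0 => ?_
    rw [maxEigenvalue, Finset.prod_eq_zero (Finset.mem_range.2 hk) h0.symm, zero_mul] at hpos
    exact lt_irrefl _ hpos
  refine hT.card_le hd hpos (by positivity)
    (pow_le_one₀ (by positivity) ((div_le_one hlam1).2 (h.1 zero_le_one)))
    (h.initialError_le (I d)) fun n hn => ?_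
  -- The coordinates in `I` carry the indices `0, …, #I - 1` once each; among the free ones, exactly
  -- those in `K` use the second eigenvalue. The product is then exactly `L * (lam 1 / lam 0) ^ i`.
  let j : Finset.powersetCard i (I d)ᶜ → Fin d → ℕ := fun K l =>
    if hl : l ∈ I d then ((I d).equivFin ⟨l, hl⟩ : ℕ) else if l ∈ K.1 then 1 else 0
  have hjI : ∀ K (l : I d), j K l = (I d).equivFin l := fun K l => dif_pos l.2
  have hjc : ∀ K, ∀ l ∉ I d, j K l = if l ∈ K.1 then 1 else 0 := fun K l hl => dif_neg hl
  refine h.le_minimalError j (fun K l => ?_) (fun K x hx y hy hxy => ?_)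
    (fun K K' hK π hπ heq => hK ?_) (fun K => ?_)
    (by rwa [Fintype.card_coe, Finset.card_powersetCard])
  · by_cases hl : l ∈ I d
    · rw [hjI K ⟨l, hl⟩]
      exact hposI _ (Fin.is_lt _)
    · rw [hjc K l hl]
      split_ifs <;> assumption
  · rw [hjI K ⟨x, hx⟩, hjI K ⟨y, hy⟩] at hxy
    exact congrArg Subtype.val ((I d).equivFin.injective (Fin.ext hxy))
  -- Permutations in question fix the free coordinates, so `K` can be read off from the orbit.
  · ext l
    have hsub : ∀ K : Finset.powersetCard i (I d)ᶜ, l ∈ K.1 → l ∉ I d := fun K hl =>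
      Finset.mem_compl.1 ((Finset.mem_powersetCard.1 K.2).1 hl)
    by_cases hl : l ∈ I d
    · exact ⟨fun h1 => absurd hl (hsub K h1), fun h1 => absurd hl (hsub K' h1)⟩
    · have h1 := congrFun heq l
      rw [Function.comp_apply, mem_permsFixingCompl.1 hπ l hl, hjc K l hl, hjc K' l hl] at h1
      by_cases h2 : l ∈ K.1 <;> by_cases h3 : l ∈ K'.1 <;> simp_all
  · obtain ⟨hKs, hKc⟩ := Finset.mem_powersetCard.1 K.2
    refine le_of_eq ?_
    have h1 : ∏ l ∈ I d, lam (j K l) = ∏ k ∈ Finset.range (I d).card, lam k := by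
      rw [← Finset.prod_coe_sort, ← Fin.prod_univ_eq_prod_range,
        ← Equiv.prod_comp (I d).equivFin]
      exact Finset.prod_congr rfl fun l _ => by rw [hjI K l]
    have h2 : ∏ l ∈ (I d)ᶜ, lam (j K l) = lam 1 ^ i * lam 0 ^ ((I d)ᶜ.card - i) := by
      have hKc' : ((I d)ᶜ \ K.1).card = (I d)ᶜ.card - i := by
        rw [Finset.card_sdiff_of_subset hKs, hKc]
      rw [← Finset.prod_sdiff hKs, mul_comm, ← hKc']
      nth_rewrite 3 [← hKc]
      rw [← Finset.prod_const, ← Finset.prod_const]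
      congr 1
      · exact Finset.prod_congr rfl fun l hl => by
          rw [hjc K l (Finset.mem_compl.1 (hKs hl)), if_pos hl]
      · refine Finset.prod_congr rfl fun l hl => ?_
        rw [Finset.mem_sdiff] at hl
        rw [hjc K l (Finset.mem_compl.1 hl.1), if_neg hl.2]
    rw [← Finset.prod_mul_prod_compl (I d) fun l => lam (j K l), h1, h2, maxEigenvalue, div_pow,
      ← Nat.sub_add_cancel (hKc ▸ Finset.card_le_card hKs : i ≤ (I d)ᶜ.card), pow_add,
      Nat.add_sub_cancel]
    field_simp

/-- The number of coordinates without symmetry conditions grows at most logarithmically. -/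
theorem exists_card_compl_le (h : IsEigenvalueSequence (S.adjoint ∘L S) lam) (hlam2 : 0 < lam 1)
    (hT : IsPolyTractableNormalizedWith (fun d => antisymmetricProblem S (I d)) C p q)
    (hinit : ∀ d, 1 ≤ d → 0 < initialError (antisymmetricProblem S (I d))) :
    ∃ a c : ℝ, 0 ≤ a ∧ 0 ≤ c ∧ ∀ d, 1 ≤ d → ((I d)ᶜ.card : ℝ) ≤ a + c * (q * Real.log d) := by
  have hlam1 : 0 < lam 0 := hlam2.trans_le (h.1 zero_le_one)
  set R : ℝ := (lam 1 / lam 0) ^ (-(p / 2)) with hR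
  have hR0 : 0 < R := by positivity
  -- Chosen so that `s * R = 1 / 2`: the weighted binomial bounds become a geometric series with sum
  -- at most 2.
  set s : ℝ := (2 * R)⁻¹ with hs
  have hs0 : 0 < s := by positivity
  have hC := hT.1
  set K : ℝ := C * 2 ^ p * 2 with hK
  have hK0 : 0 < K := by positivity
  have hlog : 0 < Real.log (1 + s) := Real.log_pos (by linarith)
  -- Take logarithms in `(1 + s) ^ b ≤ K * d ^ q`. Keeping `q` visible lets `q = 0` yield a uniform
  -- bound.
  refine ⟨|Real.log K| / Real.log (1 + s), 1 / Real.log (1 + s), by positivity, by positivity,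
    fun d hd => ?_⟩
  have hd0 : (0 : ℝ) < d := by exact_mod_cast hd
  set b := (I d)ᶜ.card
  have hterm : ∀ i ∈ Finset.range (b + 1), s ^ i * 1 ^ (b - i) * (b.choose i : ℝ) ≤
      C * 2 ^ p * (d : ℝ) ^ q * (1 / 2) ^ i := fun i _ => by
    have h1 := choose_le_of_isPolyTractable h hlam2 hT hd (hinit d hd) i
    have h2 : ((lam 1 / lam 0) ^ i) ^ (-(p / 2)) = R ^ i := by
      rw [hR, ← Real.rpow_natCast, ← Real.rpow_natCast, ← Real.rpow_mul (by positivity),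
        ← Real.rpow_mul (by positivity), mul_comm]
    rw [h2] at h1
    have h3 : s ^ i * R ^ i = (1 / 2) ^ i := by
      rw [← mul_pow, hs]
      congr 1
      field_simp
    calc s ^ i * 1 ^ (b - i) * (b.choose i : ℝ) = s ^ i * (b.choose i : ℝ) := by simp
      _ ≤ s ^ i * (C * 2 ^ p * R ^ i * (d : ℝ) ^ q) :=
        mul_le_mul_of_nonneg_left h1 (by positivity)
      _ = C * 2 ^ p * (d : ℝ) ^ q * (s ^ i * R ^ i) := by ring
      _ = _ := by rw [h3]
  have hsum : (1 + s) ^ b ≤ K * (d : ℝ) ^ q := by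
    rw [add_comm, add_pow]
    refine (Finset.sum_le_sum hterm).trans ?_
    rw [← Finset.mul_sum]
    have h4 : ∑ i ∈ Finset.range (b + 1), (1 / 2 : ℝ) ^ i ≤ 2 := sum_geometric_two_le (b + 1)
    calc _ ≤ C * 2 ^ p * (d : ℝ) ^ q * 2 := mul_le_mul_of_nonneg_left h4 (by positivity)
      _ = _ := by rw [hK]; ring
  have h5 := Real.log_le_log (by positivity) hsum
  rw [Real.log_pow, Real.log_mul hK0.ne' (by positivity), Real.log_rpow hd0] at h5
  rw [one_div_mul_eq_div, ← add_div, le_div_iff₀ hlog]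
  linarith [le_abs_self (Real.log K)]

/-- For `d = 1` antisymmetry imposes nothing. Counting the `n + 1` eigenvalues at least `lam n`
gives `lam n ≤ const * (n + 1) ^ (-2 / p)`, and `2 * τ / p > 1` makes the `τ`-th powers summable. -/
theorem memℓp_of_isPolyTractable (h : IsEigenvalueSequence (S.adjoint ∘L S) lam)
    (hT : IsPolyTractableNormalizedWith (fun d => antisymmetricProblem S (I d)) C p q)
    (hinit : 0 < initialError (antisymmetricProblem S (I 1))) {τ : ℝ}
    (hτ : p / 2 < τ) : Memℓp lam (ENNReal.ofReal τ) := by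
  have hC := hT.1
  have hp := hT.2.1
  have hτ0 : 0 < τ := by linarith
  have hpos := h.maxEigenvalue_pos hinit
  set L := maxEigenvalue lam (I 1) with hLdef
  set K : ℝ := C * 2 ^ p with hK
  have hK0 : 0 < K := by positivity
  have hlamL : ∀ n, lam n ≤ L := fun n => by
    have h1 := prod_le_maxEigenvalue h.1 h.2.1 (I := I 1) (j := fun _ => n)
      fun x _ y _ _ => Subsingleton.elim x y
    simpa using h1
  have hbound : ∀ n, lam n ^ τ ≤ (L ^ τ * K ^ (2 * τ / p)) * (1 / ((n : ℝ) + 1) ^ (2 * τ / p)) := by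
    intro n
    rcases (h.2.1 n).eq_or_lt with h0 | h0
    · rw [← h0, Real.zero_rpow hτ0.ne']
      positivity
    have hcard : (((n + 1 : ℕ)) : ℝ) ≤ C * 2 ^ p * (lam n / L) ^ (-(p / 2)) * ((1 : ℕ) : ℝ) ^ q := by
      refine hT.card_le le_rfl hpos (by positivity) ((div_le_one hpos).2 (hlamL n))
        (h.initialError_le (I 1)) fun k hk => ?_
      rw [mul_div_cancel₀ _ hpos.ne']
      refine h.le_minimalError (ι := Fin (n + 1)) (fun i _ => i)
        (fun i _ => h0.trans_le (h.1 (Nat.lt_succ_iff.1 i.2)))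
        (fun i x _ y _ _ => Subsingleton.elim x y) (fun i k hik π _ heq => hik ?_) (fun i => ?_)
        (by simpa using hk)
      · exact Fin.ext (congrFun heq 0)
      · simpa using h.1 (Nat.lt_succ_iff.1 i.2)
    rw [Nat.cast_one, Real.one_rpow, mul_one, ← hK, Real.rpow_neg (by positivity), Nat.cast_add,
      Nat.cast_one] at hcard
    have hn0 : (0 : ℝ) < (n : ℝ) + 1 := by positivity
    have hr0 : 0 < lam n / L := by positivity
    have h2 : (lam n / L) ^ (p / 2) ≤ K / ((n : ℝ) + 1) := by
      rw [le_div_iff₀ hn0, mul_comm]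
      rwa [← div_eq_mul_inv, le_div_iff₀ (by positivity)] at hcard
    have h3 : (lam n / L) ^ τ ≤ (K / ((n : ℝ) + 1)) ^ (2 * τ / p) := by
      have h4 := Real.rpow_le_rpow (by positivity) h2 (by positivity : 0 ≤ 2 * τ / p)
      rw [← Real.rpow_mul hr0.le] at h4
      have h5 : p / 2 * (2 * τ / p) = τ := by field_simp
      rwa [h5] at h4
    rw [Real.div_rpow h0.le hpos.le, Real.div_rpow hK0.le hn0.le, div_le_iff₀ (by positivity)] at h3
    refine h3.trans (le_of_eq ?_)
    ring
  refine memℓp_gen ?_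
  rw [ENNReal.toReal_ofReal hτ0.le]
  have hsum : Summable fun n : ℕ => 1 / ((n : ℝ) + 1) ^ (2 * τ / p) := by
    have h1 := (summable_nat_add_iff 1).2 (Real.summable_one_div_nat_rpow.2
      (by rw [lt_div_iff₀ hp]; linarith : 1 < 2 * τ / p))
    simpa using h1
  refine Summable.of_nonneg_of_le (fun n => by positivity) (fun n => ?_)
    (hsum.mul_left (L ^ τ * K ^ (2 * τ / p)))
  rw [Real.norm_of_nonneg (h.2.1 n)]
  exact hbound n

theorem tendsto_zero_of_isPolyTractable (h : IsEigenvalueSequence (S.adjoint ∘L S) lam)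
    (hT : IsPolyTractableNormalizedWith (fun d => antisymmetricProblem S (I d)) C p q)
    (hinit : 0 < initialError (antisymmetricProblem S (I 1))) :
    Filter.Tendsto lam Filter.atTop (nhds 0) := by
  have hp := hT.2.1
  have h1 := memℓp_of_isPolyTractable h hT hinit (show p / 2 < p by linarith)
  have h2 := (h1.summable (by rwa [ENNReal.toReal_ofReal hp.le])).tendsto_atTop_zero
  rw [ENNReal.toReal_ofReal hp.le] at h2
  have h3 := h2.rpow_const (p := p⁻¹) (Or.inr (by positivity))
  rw [Real.zero_rpow (by positivity)] at h3
  refine h3.congr fun n => ?_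
  rw [Real.norm_of_nonneg (h.2.1 n), Real.rpow_rpow_inv (h.2.1 n) hp.ne']

end Tractable

/-! ### Decay of the initial error and conclusion -/

/-- Once the factors are at most `1 / 2`, the product times `2 ^ a` no longer increases; the
constant absorbs the finitely many earlier values. -/
theorem prod_range_le_of_tendsto_zero {lam : ℕ → ℝ} (h0 : ∀ m, 0 ≤ lam m)
    (h : Filter.Tendsto lam Filter.atTop (nhds 0)) :
    ∃ K, 0 < K ∧ ∀ a, ∏ i ∈ Finset.range a, lam i ≤ K * (1 / 2) ^ a := by
  obtain ⟨N, hN⟩ := Filter.eventually_atTop.1 (h.eventually_le_const (by norm_num : (0 : ℝ) < 1 / 2))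
  set f : ℕ → ℝ := fun a => (∏ i ∈ Finset.range a, lam i) * 2 ^ a with hf
  have hf0 : ∀ a, 0 ≤ f a := fun a =>
    mul_nonneg (Finset.prod_nonneg fun i _ => h0 i) (by positivity)
  have hfN : ∀ a, N ≤ a → f a ≤ f N := fun a ha => by
    induction a, ha using Nat.le_induction with
    | base => exact le_rfl
    | succ a ha ih =>
      refine le_trans ?_ ih
      have h1 : f (a + 1) = f a * (lam a * 2) := by
        simp only [hf, Finset.prod_range_succ]
        ring
      rw [h1]
      exact mul_le_of_le_one_right (hf0 a) (by linarith [hN a ha])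
  have hle : ∀ i ≤ N, f i ≤ ∑ i ∈ Finset.range (N + 1), f i := fun i hi =>
    Finset.single_le_sum (fun i _ => hf0 i) (Finset.mem_range.2 (by omega))
  refine ⟨1 + ∑ i ∈ Finset.range (N + 1), f i,
    by linarith [Finset.sum_nonneg fun i (_ : i ∈ Finset.range (N + 1)) => hf0 i], fun a => ?_⟩
  rw [one_div, inv_pow, ← div_eq_mul_inv, le_div_iff₀ (by positivity)]
  change f a ≤ _
  rcases le_total a N with ha | ha
  · linarith [hle a ha]
  · linarith [hfN a ha, hle N le_rfl]

/-- Exponential bound for the largest eigenvalue when almost all coordinates are antisymmetric. -/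
theorem tendsto_pow_mul_sqrt_maxEigenvalue {lam : ℕ → ℝ} (h0 : ∀ m, 0 ≤ lam m)
    (h : Filter.Tendsto lam Filter.atTop (nhds 0)) {I : ∀ d : ℕ, Finset (Fin d)}
    (hI : (fun d : ℕ => ((I d)ᶜ.card : ℝ)) =o[Filter.atTop] fun d : ℕ => (d : ℝ)) (k : ℕ) :
    Filter.Tendsto (fun d : ℕ => (d : ℝ) ^ k * √(maxEigenvalue lam (I d))) Filter.atTop
      (nhds 0) := by
  obtain ⟨K, hK0, hK⟩ := prod_range_le_of_tendsto_zero h0 h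
  -- Each free coordinate costs at most `lam 0 + 1` and forfeits one factor `1 / 2`; adding 1
  -- ensures `log M > 0`.
  set M : ℝ := 2 * (lam 0 + 1) with hM
  have hM1 : 1 < M := by linarith [h0 0]
  have hlogM : 0 < Real.log M := Real.log_pos hM1
  have hlog2 : 0 < Real.log 2 := Real.log_pos (by norm_num)
  -- Since eventually `M ^ b ≤ 2 ^ (d / 2)`, there remains `2 ^ (-d / 2) = ρ ^ (2 * d)`, whose
  -- square root is `ρ ^ d`.
  set ρ : ℝ := Real.exp (-(Real.log 2 / 4)) with hρ
  have hρ0 : 0 < ρ := Real.exp_pos _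
  have hρ1 : ρ < 1 := Real.exp_zero ▸ Real.exp_lt_exp.2 (by linarith)
  have hlim : Filter.Tendsto (fun d : ℕ => √K * ((d : ℝ) ^ k * ρ ^ d)) Filter.atTop (nhds 0) := by
    have := (tendsto_pow_const_mul_const_pow_of_abs_lt_one k
      (by rwa [abs_of_pos hρ0] : |ρ| < 1)).const_mul (√K)
    simpa using this
  refine squeeze_zero' (Filter.Eventually.of_forall fun d => by positivity) ?_ hlim
  filter_upwards [hI.bound (show 0 < Real.log 2 / 2 / Real.log M by positivity)] with d hd
  rw [Real.norm_of_nonneg (by positivity), Real.norm_of_nonneg (by positivity), div_mul_eq_mul_div,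
    le_div_iff₀ hlogM] at hd
  rw [mul_left_comm]
  refine mul_le_mul_of_nonneg_left ?_ (by positivity)
  refine Real.sqrt_le_iff.2 ⟨by positivity, ?_⟩
  rw [mul_pow, Real.sq_sqrt hK0.le]
  have hcard : (I d).card + (I d)ᶜ.card = d := by
    rw [Finset.card_add_card_compl, Fintype.card_fin]
  set a := (I d).card with ha
  set b := (I d)ᶜ.card with hb
  have h1 : lam 0 ^ b ≤ (lam 0 + 1) ^ b := pow_le_pow_left₀ (h0 0) (by linarith) b
  have h2 : (1 / 2 : ℝ) ^ a * (lam 0 + 1) ^ b = (1 / 2) ^ d * M ^ b := by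
    rw [hM, ← hcard, pow_add, mul_pow, one_div, mul_assoc, ← mul_assoc _ (2 ^ b), ← mul_pow]
    norm_num
  have h3 : (1 / 2 : ℝ) ^ d * M ^ b ≤ (ρ ^ d) ^ 2 := by
    have e1 : (1 / 2 : ℝ) ^ d = Real.exp (-(d * Real.log 2)) := by
      rw [Real.exp_neg, mul_comm, Real.exp_mul, Real.exp_log two_pos, Real.rpow_natCast, one_div,
        inv_pow]
    have e2 : M ^ b = Real.exp (b * Real.log M) := by
      rw [mul_comm, Real.exp_mul, Real.exp_log (by linarith), Real.rpow_natCast]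
    rw [e1, e2, hρ, ← Real.exp_add, ← Real.exp_nat_mul, ← Real.exp_nat_mul, Real.exp_le_exp]
    push_cast
    linarith
  calc maxEigenvalue lam (I d) ≤ K * (1 / 2) ^ a * (lam 0 + 1) ^ b :=
        mul_le_mul (hK a) h1 (pow_nonneg (h0 0) _) (by positivity)
    _ = K * ((1 / 2 : ℝ) ^ d * M ^ b) := by rw [mul_assoc, h2]
    _ ≤ K * (ρ ^ d) ^ 2 := mul_le_mul_of_nonneg_left h3 hK0.le

theorem mainTheorem8 {𝕜 : Type*} [RCLike 𝕜]
    {H G : Type*} [NormedAddCommGroup H] [InnerProductSpace 𝕜 H] [CompleteSpace H]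
    [NormedAddCommGroup G] [InnerProductSpace 𝕜 G] [CompleteSpace G]
    (S : H →L[𝕜] G) (hS : IsCompactOperator S)
    (lam : ℕ → ℝ) (hlam : IsEigenvalueSequence (S.adjoint ∘L S) lam)
    (hlam2 : 0 < lam 1)
    (I : ∀ d : ℕ, Finset (Fin d)) (hI : ∀ d, 1 ≤ d → (I d).Nonempty)
    (hinit : ∀ d, 1 ≤ d → 0 < initialError (antisymmetricProblem S (I d))) :
    (∀ C p q : ℝ,
      IsPolyTractableNormalizedWith (fun d => antisymmetricProblem S (I d)) C p q →
        (∀ τ : ℝ, p / 2 < τ → Memℓp lam (ENNReal.ofReal τ)) ∧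
        (∀ k : ℕ, Filter.Tendsto
          (fun d : ℕ => (d : ℝ≥0∞) ^ k * initialError (antisymmetricProblem S (I d)))
          Filter.atTop (nhds 0)) ∧
        (fun d : ℕ => (d : ℝ) - ((I d).card : ℝ)) =O[Filter.atTop] (fun d : ℕ => Real.log d) ∧
        Filter.Tendsto (fun d : ℕ => ((I d).card : ℝ) / (d : ℝ)) Filter.atTop (nhds 1)) ∧
    (IsStronglyPolyTractableNormalized (fun d => antisymmetricProblem S (I d)) →
      (fun d : ℕ => (d : ℝ) - ((I d).card : ℝ)) =O[Filter.atTop] (fun _ : ℕ => (1 : ℝ))) := by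
  have hcard : ∀ d : ℕ, (d : ℝ) - ((I d).card : ℝ) = ((I d)ᶜ.card : ℝ) := fun d => by
    have h1 : (I d).card + (I d)ᶜ.card = d := by
      rw [Finset.card_add_card_compl, Fintype.card_fin]
    have h2 : ((I d).card : ℝ) + ((I d)ᶜ.card : ℝ) = d := by exact_mod_cast h1
    linarith
  simp only [hcard]
  refine ⟨fun C p q hT => ?_, fun ⟨C, p, hT⟩ => ?_⟩
  · have hlog : (fun d : ℕ => ((I d)ᶜ.card : ℝ)) =O[Filter.atTop] fun d : ℕ => Real.log d := by
      obtain ⟨a, c, ha, hc, hac⟩ := exists_card_compl_le hlam hlam2 hT hinit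
      refine Asymptotics.IsBigO.of_bound (a + c * q) ?_
      -- From `d = 3 > e` on, `log d ≥ 1` absorbs the additive constant `a`.
      filter_upwards [Filter.eventually_ge_atTop 3] with d hd
      have hd1 : 1 ≤ Real.log d := by
        rw [Real.le_log_iff_exp_le (by positivity)]
        have : (3 : ℝ) ≤ d := by exact_mod_cast hd
        linarith [Real.exp_one_lt_three]
      rw [Real.norm_of_nonneg (by positivity), Real.norm_of_nonneg (by linarith)]
      have := hac d (by omega)
      nlinarith
    have hlittle : (fun d : ℕ => ((I d)ᶜ.card : ℝ)) =o[Filter.atTop] fun d : ℕ => (d : ℝ) :=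
      hlog.trans_isLittleO (Real.isLittleO_log_id_atTop.comp_tendsto tendsto_natCast_atTop_atTop)
    refine ⟨fun τ hτ => memℓp_of_isPolyTractable hlam hT (hinit 1 le_rfl) hτ, fun k => ?_, hlog, ?_⟩
    · have h1 := ENNReal.tendsto_ofReal (tendsto_pow_mul_sqrt_maxEigenvalue hlam.2.1
        (tendsto_zero_of_isPolyTractable hlam hT (hinit 1 le_rfl)) hlittle k)
      rw [ENNReal.ofReal_zero] at h1
      refine tendsto_of_tendsto_of_tendsto_of_le_of_le tendsto_const_nhds h1 (fun _ => zero_le)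
        fun d => ?_
      beta_reduce
      rw [ENNReal.ofReal_mul (by positivity), ENNReal.ofReal_pow (by positivity),
        ENNReal.ofReal_natCast]
      exact mul_le_mul_right (hlam.initialError_le (I d)) _
    · have h1 := hlittle.tendsto_div_nhds_zero.const_sub 1
      rw [sub_zero] at h1
      refine h1.congr' ?_
      filter_upwards [Filter.eventually_ge_atTop 1] with d hd
      have hd0 : (d : ℝ) ≠ 0 := by positivity
      rw [← hcard]
      field_simp
      ring
  · obtain ⟨a, c, -, -, hac⟩ := exists_card_compl_le hlam hlam2 hT hinit
    refine Asymptotics.IsBigO.of_bound a ?_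
    filter_upwards [Filter.eventually_ge_atTop 1] with d hd
    rw [Real.norm_of_nonneg (by positivity), norm_one, mul_one]
    simpa using hac d hd
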